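/- Let $F$ be the following set of $24$ oriented triangles (each taken up to cyclic rotation) of a triangulation of the closed orientable surface of genus $2$ with vertices $0,\dots,9$: $$\begin{gathered} (0,1,7),\ (0,2,1),\ (0,3,6),\ (0,4,9),\ (0,5,3),\ (0,6,4), \\ (0,7,8),\ (0,8,5),\ (0,9,2),\ (1,2,4),\ (1,3,7),\ (1,4,6), \\ (1,5,8),\ (1,6,5),\ (1,8,3),\ (2,3,8),\ (2,6,3),\ (2,7,4), \\ (2,8,7),\ (2,9,6),\ (3,4,7),\ (3,5,4),\ (4,5,9),\ (5,6,9) \end{gathered}$$ Let $x_i, y_i, \hat z_i$ ($0\le i\le 9$) be the numbers $$\begin{array}{c|ccc} i & x_i & y_i & \hat z_i \\ \hline 0 & 0.7315 & 0.0202 & 0.28688022781563440615364787558404 \\ 1 & -0.316 & 0.5792 & -0.2252919753182150895621576631383 \\ 2 & 0.3426 & -0.592 & -0.22851917827575874828458055465199 \\ 3 & -0.4323 & -0.592 & -0.23272863894943839798113773793091 \\ 4 & -0.7303 & 0.04 & -0.22959077803009316431117678104662 \\ 5 & 0.1464 & 0.6149 & 0.13588682780065943976868637469759 \\ 6 & -0.5154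 & 0.0395 & 0.46102777383206591809202059407883 \\ 7 & 0.6649 & -0.1156 & -0.22651115997910956793325851442687 \\ 8 & 0.152 & 0.2539 & -0.23985732806740791506457015735734 \\ 9 & -0.03 & 0.0606 & 0.64396456614136038886542316026992 \end{array}$$ and put $\hat z=(\hat z_0,\dots,\hat z_9)\in\mathbb R^{10}$. For $z\in\mathbb R^{10}$ let $X_i=X_i(z)=(x_i,y_i,z_i)\in\mathbb R^3$. When the points $X_i$ lie in the open unit ball, regard them as points of the Beltrami–Klein model of $\mathbb H^3$, with metric $$\langle V,W\rangle_X=\frac{\langle V,W\rangle}{1-\|X\|^2}+\frac{\langle X,V\rangle\langle X,W\rangle}{(1-\|X\|^2)^2},\qquad \|V\|_X=\sqrt{\langle V,V\rangle_X}.$$ For $(i,j,k)\in F$ (or a cyclic rotation of it) the hyperbolic angle at $X_i$ of the triangle $X_iX_jX_k$ is, with $V=X_j-X_i$, $W=X_k-X_i$, $$\theta_{ijk}(z)=\arccos\frac{\langle V,W\rangle_{X_i}}{\|V\|_{X_i}\|W\|_{X_i}}.$$ The cone angle $\theta_i(z)$ is the sum of the $\theta_{ijk}(z)$ over all triangles of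 $F$ having $i$ as a vertex (rotated so that $i$ comes first), and $$\Theta(z)=(\theta_0(z)-2\pi,\dots,\theta_9(z)-2\pi).$$ A map $f$ into $\mathbb R^n$, smooth near every point of $A\subset\mathbb R^n$, is called $\lambda$-expansive on $A$ if for all unit vectors $V\in\mathbb R^n$ and all $p,q\in A$ one has $\|df|_p(V)\|>2\lambda$, and the angle between $df|_p(V)$ and $df|_q(V)$ is less than $\pi/3$. Let $B_r(\hat z)$ be the open Euclidean ball of radius $r$ around $\hat z$, and let $M=(M_{ij})_{0\le i,j\le 9}$ be the matrix $$M=\begin{pmatrix} -7.526 & 0.793 & -0.228 & -0.264 & -0.782 & 1.372 & 1.173 & -0.098 & 0.192 & 2.158 \\ 0.684 & 4.991 & -0.344 & -0.104 & -1.468 & -0.260 & 0.208 & -0.661 & -1.528 & 0 \\ -0.203 & -0.356 & 3.913 & -1.008 & -0.104 & 0 & -0.091 & -0.588 & -0.017 & 0.224 \\ -0.255 & -0.116 & -1.093 & 4.665 & -0.847 & -0.035 & 0.117 & -0.133 & -0.037 & 0 \\ -0.753 & -1.639 & -0.112 & -0.843 & 5.270 & -0.642 & 0.820 & 0.015 &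 0 & 0.870 \\ 1.112 & -0.244 & 0 & -0.029 & -0.540 & -2.245 & 0.162 & 0 & -0.369 & 1.354 \\ 1.006 & 0.207 & -0.087 & 0.104 & 0.730 & 0.172 & -9.148 & 0 & 0 & 3.639 \\ -0.086 & -0.674 & -0.580 & -0.121 & 0.013 & 0 & 0 & 5.063 & -1.681 & 0 \\ 0.128 & -1.185 & -0.013 & -0.026 & 0 & -0.305 & 0 & -1.277 & 3.455 & 0 \\ 1.751 & 0 & 0.204 & 0 & 0.733 & 1.355 & 3.444 & 0 & 0 & -11.599 \end{pmatrix}.$$ **Proposition.** 1. For every $z\in B_{10^{-18}}(\hat z)$ all points $X_i(z)$ lie in the open unit ball and all triangles $X_iX_jX_k$, $(i,j,k)\in F$, are nondegenerate. 2. $\Theta$ is $\tfrac12$-expansive (in particular smooth) on $B_{10^{-18}}(\hat z)$. 3. For all $z\in B_{10^{-18}}(\hat z)$ and all $i,j,k$, $\left|\dfrac{\partial^2\Theta_i}{\partial z_j\,\partial z_k}(z)\right|\le 10^{14}$. 4. For all $z\in B_{10^{-18}}(\hat z)$ and all $i,j$, $\left|\dfrac{\partial\Theta_j}{\partial z_i}(z)-M_{ij}\right|<0.002$;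 that is, the Jacobian matrix of $\Theta$ at $z$ differs from $M^{T}$ by a matrix all of whose entries are less than $0.002$ in absolute value. 5. The characteristic polynomial of $M^{T}M$ has ten distinct real roots, all greater than $2.25$, and the smallest singular value of $M$ is greater than $1.5$. 6. There is $z\in B_{5\cdot10^{-19}}(\hat z)$ with $\Theta(z)=0$. -/

import Mathlib

open scoped ContDiff

noncomputable section

namespace HypOrigami

/-- The inner product on the tangent space at `X` of the Beltrami-Klein model of hyperbolic 3-space
(the open Euclidean unit ball), where tangent vectors are identified with vectors of `ℝ³`. -/
def kleinInner (X V W : EuclideanSpace ℝ (Fin 3)) : ℝ :=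
  inner ℝ V W / (1 - ‖X‖ ^ 2) + inner ℝ X V * inner ℝ X W / (1 - ‖X‖ ^ 2) ^ 2

/-- The norm of the tangent vector `V` at `X` in the Beltrami-Klein model. -/
def kleinNorm (X V : EuclideanSpace ℝ (Fin 3)) : ℝ :=
  Real.sqrt (kleinInner X V V)

/-- The hyperbolic angle at `X` of the geodesic triangle with vertices `X, Y, Z`.  Geodesics of the
Beltrami-Klein model are straight segments, so `Y - X` and `Z - X` are tangent to its sides. -/
def kleinAngle (X Y Z : EuclideanSpace ℝ (Fin 3)) : ℝ :=
  Real.arccos (kleinInner X (Y - X) (Z - X) / (kleinNorm X (Y - X) * kleinNorm X (Z - X)))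

/-- The 24 oriented triangles of the 10-vertex triangulation of the genus 2 surface. -/
def faces : Finset (Fin 10 × Fin 10 × Fin 10) :=
  {(0, 1, 7), (0, 2, 1), (0, 3, 6), (0, 4, 9), (0, 5, 3), (0, 6, 4),
   (0, 7, 8), (0, 8, 5), (0, 9, 2), (1, 2, 4), (1, 3, 7), (1, 4, 6),
   (1, 5, 8), (1, 6, 5), (1, 8, 3), (2, 3, 8), (2, 6, 3), (2, 7, 4),
   (2, 8, 7), (2, 9, 6), (3, 4, 7), (3, 5, 4), (4, 5, 9), (5, 6, 9)}

/-- The 72 corners of the triangulation: every oriented triangle is listed in its three cyclic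
rotations, and `(i, j, k)` stands for the corner at `i` of the triangle `(i, j, k)`. -/
def corners : Finset (Fin 10 × Fin 10 × Fin 10) :=
  faces ∪ faces.image (fun t => (t.2.1, t.2.2, t.1)) ∪ faces.image (fun t => (t.2.2, t.1, t.2.1))

/-- The cone angle at vertex `i` of the polyhedral surface with vertex positions `P`. -/
def coneAngle (P : Fin 10 → EuclideanSpace ℝ (Fin 3)) (i : Fin 10) : ℝ :=
  ∑ t ∈ corners.filter (fun t => t.1 = i), kleinAngle (P t.1) (P t.2.1) (P t.2.2)

/-- The fixed first coordinates of the vertices. -/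
def xCoord : Fin 10 → ℝ :=
  ![0.7315, -0.316, 0.3426, -0.4323, -0.7303,
    0.1464, -0.5154, 0.6649, 0.152, -0.03]

/-- The fixed second coordinates of the vertices. -/
def yCoord : Fin 10 → ℝ :=
  ![0.0202, 0.5792, -0.592, -0.592, 0.04,
    0.6149, 0.0395, -0.1156, 0.2539, 0.0606]

/-- The vector of third coordinates of the candidate surface. -/
def zHat : EuclideanSpace ℝ (Fin 10) := WithLp.toLp 2
  ![0.28688022781563440615364787558404,
    -0.2252919753182150895621576631383,
    -0.22851917827575874828458055465199,
    -0.23272863894943839798113773793091,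
    -0.22959077803009316431117678104662,
    0.13588682780065943976868637469759,
    0.46102777383206591809202059407883,
    -0.22651115997910956793325851442687,
    -0.23985732806740791506457015735734,
    0.64396456614136038886542316026992]

/-- The vertices of the surface whose vector of third coordinates is `z`. -/
def vertex (z : EuclideanSpace ℝ (Fin 10)) (i : Fin 10) : EuclideanSpace ℝ (Fin 3) :=
  !₂[xCoord i, yCoord i, z i]

/-- The cone angle defect map `z ↦ (θ₀(z) - 2π, …, θ₉(z) - 2π)`. -/
def Theta (z : EuclideanSpace ℝ (Fin 10)) : EuclideanSpace ℝ (Fin 10) :=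
  WithLp.toLp 2 (fun i => coneAngle (vertex z) i - 2 * Real.pi)

/-- The partial derivative of `f` in the direction of the `j`-th coordinate. -/
def partialDeriv {n : ℕ} (j : Fin n) (f : EuclideanSpace ℝ (Fin n) → ℝ) :
    EuclideanSpace ℝ (Fin n) → ℝ :=
  fun z => fderiv ℝ f z (EuclideanSpace.single j 1)

/-- `f` is `c`-expansive on `A`: it is smooth near every point of `A`, its differentials at points
of `A` stretch unit vectors by more than `2 * c`, and the images of a unit vector under the
differentials at any two points of `A` make an angle less than `π / 3`. -/
def IsExpansiveOn {n : ℕ} (c : ℝ) (f : EuclideanSpace ℝ (Fin n) → EuclideanSpace ℝ (Fin n))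
    (A : Set (EuclideanSpace ℝ (Fin n))) : Prop :=
  (∀ p ∈ A, ContDiffAt ℝ ∞ f p) ∧
  ∀ V : EuclideanSpace ℝ (Fin n), ‖V‖ = 1 → ∀ p ∈ A, ∀ q ∈ A,
    2 * c < ‖fderiv ℝ f p V‖ ∧
    InnerProductGeometry.angle (fderiv ℝ f p V) (fderiv ℝ f q V) < Real.pi / 3

/-- The explicit approximation to the differential of `Theta` near `zHat`.  Row `i` belongs to the
variable `zᵢ` and column `j` to the component `Θⱼ`. -/
def M : Matrix (Fin 10) (Fin 10) ℝ :=
  !![-7.526, 0.793, -0.228, -0.264, -0.782, 1.372, 1.173, -0.098, 0.192, 2.158;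
     0.684, 4.991, -0.344, -0.104, -1.468, -0.260, 0.208, -0.661, -1.528, 0;
     -0.203, -0.356, 3.913, -1.008, -0.104, 0, -0.091, -0.588, -0.017, 0.224;
     -0.255, -0.116, -1.093, 4.665, -0.847, -0.035, 0.117, -0.133, -0.037, 0;
     -0.753, -1.639, -0.112, -0.843, 5.270, -0.642, 0.820, 0.015, 0, 0.870;
     1.112, -0.244, 0, -0.029, -0.540, -2.245, 0.162, 0, -0.369, 1.354;
     1.006, 0.207, -0.087, 0.104, 0.730, 0.172, -9.148, 0, 0, 3.639;
     -0.086, -0.674, -0.580, -0.121, 0.013, 0, 0, 5.063, -1.681, 0;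
     0.128, -1.185, -0.013, -0.026, 0, -0.305, 0, -1.277, 3.455, 0;
     1.751, 0, 0.204, 0, 0.733, 1.355, 3.444, 0, 0, -11.599]

end HypOrigami

end

namespace HypOrigami

/-! Lift a point `X` of the Klein ball to `(1, X)`. The Klein inner product of two edges at a corner
is then, up to a positive factor, a 2×2 minor `num` of Minkowski products `bil`. Hence the cosine of
the corner angle is `num / (√side √side)`, its sine is `√disc / (√side √side)` with `disc` the Gram
determinant, and the derivative `dangle` of the angle is algebraic in `z` apart from one square
root.

Rational interval arithmetic, run by the kernel on integers over `10 ^ 40`, encloses these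
quantities on the whole ball. It shows that every corner is uniformly nondegenerate
(`regular_radius`) and that every partial derivative of a cone angle is within `0.002` of the entry
of `M` (`close_all`). The second derivatives need no intervals: the bound `10 ^ 14` is so generous
that the sum, product, inverse and square root rules suffice (`JetBound`).

The spectrum of `Mᵀ M` is located by approximate integer eigenvectors. A residual of relative size
`0.02` puts an eigenvalue within `0.02` of each approximate one. The ten resulting intervals are
disjoint, so they account for all eigenvalues, and all lie above `2.25`. Thus `M` and `Mᵀ` expand by
at least `1.5`, and `dΘ`, within `0.02` of `Mᵀ` in operator norm, is expansive.

For the zero, no value of `arccos` or `π` is computed. The product of the complex numbers `num + i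
√disc` around a vertex has the cone angle as an argument, and its ratio of imaginary to real part is
enclosed at `zHat`. This gives the cone angle modulo `2π`, and coarse bounds on the corner angles
single out `2π`. So `‖Θ(zHat)‖ ≤ 10 ^ (-19)`, and the quantitative surjectivity theorem for maps
close to an invertible linear map gives an exact zero nearby. -/

/-- The denominator of the fixed-point numbers in the interval arithmetic. -/
def scale : ℤ := 10000000000000000000000000000000000000000

theorem scale_pos : (0 : ℝ) < scale := by norm_num [scale]

/-! ### Fixed-point interval arithmetic with outward rounding -/

/-- An interval whose end points are `lo / scale` and `hi / scale`. -/
structure Ival where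
  lo : ℤ
  hi : ℤ

namespace Ival

/-- The real number `x` lies in the interval. -/
def Contains (I : Ival) (x : ℝ) : Prop := (I.lo : ℝ) ≤ x * scale ∧ x * scale ≤ I.hi

/-- Evaluate a natural number before passing it on, so that the kernel does not duplicate work. -/
def forceNat {α : Type*} (n : ℕ) (f : ℕ → α) : α :=
  match n with
  | 0 => f 0
  | k + 1 => f (Nat.succ k)

/-- Evaluate an integer before passing it on. -/
def forceInt {α : Type*} (n : ℤ) (f : ℤ → α) : α :=
  match n with
  | .ofNat n => forceNat n fun n => f (.ofNat n)
  | .negSucc n => forceNat n fun n => f (.negSucc n)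

/-- An interval with evaluated end points. -/
def mkForced (lo hi : ℤ) : Ival := forceInt lo fun lo => forceInt hi fun hi => ⟨lo, hi⟩

theorem forceNat_eq {α : Type*} (n : ℕ) (f : ℕ → α) : forceNat n f = f n := by
  cases n <;> rfl

@[simp]
theorem forceInt_eq {α : Type*} (n : ℤ) (f : ℤ → α) : forceInt n f = f n := by
  cases n
  · exact forceNat_eq _ fun n => f (.ofNat n)
  · exact forceNat_eq _ fun n => f (.negSucc n)

@[simp]
theorem mkForced_eq (lo hi : ℤ) : mkForced lo hi = ⟨lo, hi⟩ := by simp [mkForced]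

/-- Sum of intervals. -/
def add : Ival → Ival → Ival
  | ⟨a, b⟩, ⟨c, d⟩ => mkForced (a + c) (b + d)

/-- Difference of intervals. -/
def sub : Ival → Ival → Ival
  | ⟨a, b⟩, ⟨c, d⟩ => mkForced (a - d) (b - c)

/-- Product of intervals, rounded outwards. -/
def mul : Ival → Ival → Ival
  | ⟨a, b⟩, ⟨c, d⟩ =>
    forceInt (a * c) fun p => forceInt (a * d) fun q => forceInt (b * c) fun r =>
      forceInt (b * d) fun s => forceInt (min p q) fun m => forceInt (min r s) fun n =>
        forceInt (max p q) fun u => forceInt (max r s) fun v =>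
          mkForced (min m n / scale) (-(-(max u v) / scale))

/-- Inverse of a positive interval, rounded outwards. -/
def inv : Ival → Ival
  | ⟨a, b⟩ => mkForced (scale * scale / b) (-(-(scale * scale) / a))

/-- Newton's iteration for the integer square root. -/
def newton (n : ℕ) : ℕ → ℕ → ℕ
  | 0, r => r
  | k + 1, r => forceNat ((r + n / r) / 2) (newton n k)

/-- A lower bound for the square root of a natural number. -/
def sqrtLower (n : ℕ) : ℕ :=
  forceNat (newton n 10 scale.toNat - 1) fun r => if r * r ≤ n then r else 0

/-- An upper bound for the square root of a natural number. -/
def sqrtUpper (n : ℕ) : ℕ :=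
  forceNat (newton n 10 scale.toNat + 1) fun r => if n ≤ r * r then r else n

/-- Square root of an interval, rounded outwards. -/
def sqrt : Ival → Ival
  | ⟨a, b⟩ => mkForced (forceNat (a * scale).toNat fun n => sqrtLower n)
    (forceNat (b * scale).toNat fun n => sqrtUpper n)

/-- Convergence of Newton's iteration plays no role: the candidate is checked by squaring, and a
trivial bound replaces it if the check fails. The same applies to the upper bound. -/
theorem sqrtLower_le (n : ℕ) : (sqrtLower n : ℝ) ≤ √n := by
  apply Real.le_sqrt_of_sq_le
  rw [sqrtLower, forceNat_eq]
  split_ifs with h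
  · rw [sq]; exact_mod_cast h
  · simp

theorem le_sqrtUpper (n : ℕ) : √n ≤ sqrtUpper n := by
  apply Real.sqrt_le_iff.2 ⟨by positivity, ?_⟩
  rw [sqrtUpper, forceNat_eq]
  split_ifs with h
  · rw [sq]; exact_mod_cast h
  · rw [sq]; exact_mod_cast Nat.le_mul_self n

theorem Contains.add {I J : Ival} {x y : ℝ} (hx : I.Contains x) (hy : J.Contains y) :
    (I.add J).Contains (x + y) := by
  obtain ⟨h1, h2⟩ := hx
  obtain ⟨h3, h4⟩ := hy
  constructor <;> simp only [Ival.add, mkForced_eq] <;> push_cast <;> linarith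

theorem Contains.sub {I J : Ival} {x y : ℝ} (hx : I.Contains x) (hy : J.Contains y) :
    (I.sub J).Contains (x - y) := by
  obtain ⟨h1, h2⟩ := hx
  obtain ⟨h3, h4⟩ := hy
  constructor <;> simp only [Ival.sub, mkForced_eq] <;> push_cast <;> linarith

/-- A product is affine in each factor, so its extrema over a rectangle are at the corners; one
factor at a time is moved to an end point. -/
theorem min_mul_le {a b c d x y : ℝ} (hx : a ≤ x ∧ x ≤ b) (hy : c ≤ y ∧ y ≤ d) :
    min (min (a * c) (a * d)) (min (b * c) (b * d)) ≤ x * y := by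
  obtain ⟨h1, h2⟩ := hx
  obtain ⟨h3, h4⟩ := hy
  have key : ∀ e : ℝ, min (e * c) (e * d) ≤ e * y := fun e => by
    rcases le_total 0 e with he | he
    · exact (min_le_left _ _).trans (mul_le_mul_of_nonneg_left h3 he)
    · exact (min_le_right _ _).trans (mul_le_mul_of_nonpos_left h4 he)
  rcases le_total 0 y with hy | hy
  · exact (min_le_left _ _).trans ((key a).trans (mul_le_mul_of_nonneg_right h1 hy))
  · exact (min_le_right _ _).trans ((key b).trans (mul_le_mul_of_nonpos_right h2 hy))

theorem le_max_mul {a b c d x y : ℝ} (hx : a ≤ x ∧ x ≤ b) (hy : c ≤ y ∧ y ≤ d) :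
    x * y ≤ max (max (a * c) (a * d)) (max (b * c) (b * d)) := by
  obtain ⟨h1, h2⟩ := hx
  obtain ⟨h3, h4⟩ := hy
  have key : ∀ e : ℝ, e * y ≤ max (e * c) (e * d) := fun e => by
    rcases le_total 0 e with he | he
    · exact (mul_le_mul_of_nonneg_left h4 he).trans (le_max_right _ _)
    · exact (mul_le_mul_of_nonpos_left h3 he).trans (le_max_left _ _)
  rcases le_total 0 y with hy | hy
  · exact (mul_le_mul_of_nonneg_right h2 hy).trans ((key b).trans (le_max_right _ _))
  · exact (mul_le_mul_of_nonpos_right h1 hy).trans ((key a).trans (le_max_left _ _))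

theorem cast_ediv_le (n m : ℤ) (hm : 0 < m) : ((n / m : ℤ) : ℝ) ≤ n / m := by
  rw [le_div_iff₀ (by exact_mod_cast hm)]
  exact_mod_cast Int.ediv_mul_le n hm.ne'

theorem le_cast_neg_ediv (n m : ℤ) (hm : 0 < m) : (n / m : ℝ) ≤ ((-(-n / m) : ℤ) : ℝ) := by
  have := cast_ediv_le (-n) m hm
  push_cast at this ⊢
  rw [neg_div] at this
  linarith

theorem Contains.mul {I J : Ival} {x y : ℝ} (hx : I.Contains x) (hy : J.Contains y) :
    (I.mul J).Contains (x * y) := by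
  have hs := scale_pos
  have hs' : 0 < scale := by exact_mod_cast hs
  simp only [Ival.mul, forceInt_eq, mkForced_eq]
  have e : x * y * scale = (x * scale) * (y * scale) / scale := by field_simp
  constructor
  · refine (cast_ediv_le _ _ hs').trans ?_
    rw [e]
    gcongr
    push_cast
    exact min_mul_le hx hy
  · refine le_trans ?_ (le_cast_neg_ediv _ _ hs')
    rw [e]
    gcongr
    push_cast
    exact le_max_mul hx hy

theorem Contains.pos {I : Ival} {x : ℝ} (hx : I.Contains x) (h : 0 < I.lo) : 0 < x := by
  have h1 : (0 : ℝ) < I.lo := by exact_mod_cast h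
  exact pos_of_mul_pos_left (h1.trans_le hx.1) scale_pos.le

theorem Contains.inv {I : Ival} {x : ℝ} (hx : I.Contains x) (h : 0 < I.lo) :
    I.inv.Contains x⁻¹ := by
  have hs := scale_pos
  have hpos := hx.pos h
  obtain ⟨h1, h2⟩ := hx
  have h0 : (0 : ℝ) < I.lo := by exact_mod_cast h
  have h3 : (0 : ℝ) < I.hi := h0.trans_le (h1.trans h2)
  simp only [Ival.inv, mkForced_eq]
  have e : x⁻¹ * scale = ((scale * scale : ℤ) : ℝ) / (x * scale) := by push_cast; field_simp
  constructor
  · refine (cast_ediv_le _ _ (by exact_mod_cast h3)).trans ?_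
    rw [e]
    push_cast
    gcongr
  · refine le_trans ?_ (le_cast_neg_ediv _ _ h)
    rw [e]
    push_cast
    gcongr

theorem Contains.sqrt {I : Ival} {x : ℝ} (hx : I.Contains x) (h0 : 0 ≤ x) :
    I.sqrt.Contains √x := by
  have hs := scale_pos
  obtain ⟨h1, h2⟩ := hx
  simp only [Ival.sqrt, forceNat_eq, mkForced_eq]
  -- The radicand carries `scale` twice because the root halves the exponent; this is why
  -- `Ival.sqrt` multiplies its end points by `scale` first.
  have e : √x * scale = √(x * scale * scale) := by
    rw [mul_assoc, Real.sqrt_mul h0, Real.sqrt_mul_self hs.le]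
  have hx0 : 0 ≤ x * scale := by positivity
  have toNat_cast : ∀ n : ℤ, ((n.toNat : ℕ) : ℝ) = max (n : ℝ) 0 := fun n => by
    have : ((n.toNat : ℤ)) = max n 0 := Int.toNat_eq_max n
    exact_mod_cast this
  constructor
  · rw [e]
    refine le_trans (by exact_mod_cast sqrtLower_le _) (Real.sqrt_le_sqrt ?_)
    rw [toNat_cast]
    push_cast
    exact max_le (by gcongr) (by positivity)
  · rw [e]
    refine le_trans (Real.sqrt_le_sqrt ?_) (by exact_mod_cast le_sqrtUpper _)
    rw [toNat_cast]
    push_cast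
    exact le_max_of_le_left (by gcongr)

/-- Sum of a list of intervals. -/
def sum : List Ival → Ival
  | [] => ⟨0, 0⟩
  | I :: l => I.add (sum l)

theorem contains_sum {α : Type*} (f : α → ℝ) (F : α → Ival) (l : List α)
    (h : ∀ t ∈ l, (F t).Contains (f t)) : (sum (l.map F)).Contains (l.map f).sum := by
  induction l with
  | nil => simp [sum, Contains]
  | cons t l ih =>
    simp only [List.map_cons, List.sum_cons, sum]
    exact (h t (by simp)).add (ih fun s hs => h s (by simp [hs]))

theorem contains_ofInt (n : ℤ) : (⟨n, n⟩ : Ival).Contains (n / scale) := by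
  have := scale_pos
  simp [Contains, this.ne']

end Ival

/-! ### The triangulation and the numerical data in integers -/

/-- The faces as a list. -/
def faceList : List (Fin 10 × Fin 10 × Fin 10) :=
  [(0, 1, 7), (0, 2, 1), (0, 3, 6), (0, 4, 9), (0, 5, 3), (0, 6, 4),
   (0, 7, 8), (0, 8, 5), (0, 9, 2), (1, 2, 4), (1, 3, 7), (1, 4, 6),
   (1, 5, 8), (1, 6, 5), (1, 8, 3), (2, 3, 8), (2, 6, 3), (2, 7, 4),
   (2, 8, 7), (2, 9, 6), (3, 4, 7), (3, 5, 4), (4, 5, 9), (5, 6, 9)]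

/-- The corners as a list. -/
def cornerList : List (Fin 10 × Fin 10 × Fin 10) :=
  faceList ++ faceList.map (fun t => (t.2.1, t.2.2, t.1)) ++
    faceList.map (fun t => (t.2.2, t.1, t.2.1))

/-- The corners at the vertex `v` as a list. -/
def cornersAt (v : Fin 10) : List (Fin 10 × Fin 10 × Fin 10) :=
  cornerList.filter (fun t => t.1 = v)

theorem cornerList_nodup : cornerList.Nodup := by
  -- The three decimal digits encode a corner injectively, so the check becomes one on natural
  -- numbers.
  refine List.Nodup.of_map (fun t => 100 * (t.1 : ℕ) + 10 * (t.2.1 : ℕ) + (t.2.2 : ℕ)) ?_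
  decide +kernel

theorem faces_eq : faces = faceList.toFinset := by
  simp only [faces, faceList, List.toFinset_cons, List.toFinset_nil]
  rfl

theorem corners_eq : corners = cornerList.toFinset := by
  ext t
  simp only [corners, cornerList, faces_eq, Finset.mem_union, Finset.mem_image, List.mem_toFinset,
    List.mem_append, List.mem_map]

theorem mem_corners_of_mem_cornersAt {v : Fin 10} {t : Fin 10 × Fin 10 × Fin 10}
    (h : t ∈ cornersAt v) : t ∈ cornerList := List.mem_of_mem_filter h

theorem sum_corners (f : Fin 10 × Fin 10 × Fin 10 → ℝ) (v : Fin 10) :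
    ∑ t ∈ corners.filter (fun t => t.1 = v), f t = ((cornersAt v).map f).sum := by
  have h : corners.filter (fun t => t.1 = v) = (cornersAt v).toFinset := by
    ext t
    simp [corners_eq, cornersAt]
  rw [h]
  exact List.sum_toFinset f (cornerList_nodup.filter _)

/-- `10 ^ 4` times the first coordinates. -/
def xInt : Fin 10 → ℤ :=
  ![7315, -3160, 3426, -4323, -7303, 1464, -5154, 6649, 1520, -300]

/-- `10 ^ 4` times the second coordinates. -/
def yInt : Fin 10 → ℤ :=
  ![202, 5792, -5920, -5920, 400, 6149, 395, -1156, 2539, 606]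

/-- `10 ^ 32` times the third coordinates of the candidate surface. -/
def zInt : Fin 10 → ℤ :=
  ![28688022781563440615364787558404, -22529197531821508956215766313830,
    -22851917827575874828458055465199, -23272863894943839798113773793091,
    -22959077803009316431117678104662, 13588682780065943976868637469759,
    46102777383206591809202059407883, -22651115997910956793325851442687,
    -23985732806740791506457015735734, 64396456614136038886542316026992]

/-- `10 ^ 3` times the entries of `M`. -/
def mInt : Matrix (Fin 10) (Fin 10) ℤ :=
  !![-7526, 793, -228, -264, -782, 1372, 1173, -98, 192, 2158;
     684, 4991, -344, -104, -1468, -260, 208, -661, -1528, 0;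
     -203, -356, 3913, -1008, -104, 0, -91, -588, -17, 224;
     -255, -116, -1093, 4665, -847, -35, 117, -133, -37, 0;
     -753, -1639, -112, -843, 5270, -642, 820, 15, 0, 870;
     1112, -244, 0, -29, -540, -2245, 162, 0, -369, 1354;
     1006, 207, -87, 104, 730, 172, -9148, 0, 0, 3639;
     -86, -674, -580, -121, 13, 0, 0, 5063, -1681, 0;
     128, -1185, -13, -26, 0, -305, 0, -1277, 3455, 0;
     1751, 0, 204, 0, 733, 1355, 3444, 0, 0, -11599]

theorem xCoord_eq (i : Fin 10) : xCoord i = xInt i / 10 ^ 4 := by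
  fin_cases i <;> norm_num [xCoord, xInt]

theorem yCoord_eq (i : Fin 10) : yCoord i = yInt i / 10 ^ 4 := by
  fin_cases i <;> norm_num [yCoord, yInt]

theorem zHat_eq (i : Fin 10) : zHat i = zInt i / 10 ^ 32 := by
  fin_cases i <;> norm_num [zHat, zInt]

theorem M_eq (i j : Fin 10) : M i j = mInt i j / 10 ^ 3 := by
  revert j
  fin_cases i <;> simp [M, mInt, Fin.forall_fin_succ] <;> norm_num

/-! ### Enclosures of the angle data and the kernel-checked certificates -/

namespace Ival

/-- Enclosure of the third coordinate of a vertex, for an error bound of `r / scale`. -/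
def coord (r : ℤ) (p : Fin 10) : Ival :=
  mkForced (zInt p * 100000000 - r) (zInt p * 100000000 + r)

/-- Enclosure of `bil`. -/
def bil (r : ℤ) (p q : Fin 10) : Ival :=
  forceInt ((100000000 - xInt p * xInt q - yInt p * yInt q) * 100000000000000000000000000000000)
    fun c => (⟨c, c⟩ : Ival).sub ((coord r p).mul (coord r q))

/-- Enclosure of `dbil`. -/
def dbil (r : ℤ) (m p q : Fin 10) : Ival :=
  (⟨0, 0⟩ : Ival).sub
    ((if p = m then coord r q else ⟨0, 0⟩).add (if q = m then coord r p else ⟨0, 0⟩))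

/-- Enclosure of `side`. -/
def side (r : ℤ) (i j : Fin 10) : Ival :=
  ((bil r i j).mul (bil r i j)).sub ((bil r i i).mul (bil r j j))

/-- Enclosure of `dside`. -/
def dside (r : ℤ) (m i j : Fin 10) : Ival :=
  (((dbil r m i j).mul (bil r i j)).add ((bil r i j).mul (dbil r m i j))).sub
    (((dbil r m i i).mul (bil r j j)).add ((bil r i i).mul (dbil r m j j)))

/-- Enclosure of `num`. -/
def num (r : ℤ) (t : Fin 10 × Fin 10 × Fin 10) : Ival :=
  ((bil r t.1 t.2.1).mul (bil r t.1 t.2.2)).sub ((bil r t.1 t.1).mul (bil r t.2.1 t.2.2))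

/-- Enclosure of `dnum`. -/
def dnum (r : ℤ) (m : Fin 10) (t : Fin 10 × Fin 10 × Fin 10) : Ival :=
  (((dbil r m t.1 t.2.1).mul (bil r t.1 t.2.2)).add
    ((bil r t.1 t.2.1).mul (dbil r m t.1 t.2.2))).sub
  (((dbil r m t.1 t.1).mul (bil r t.2.1 t.2.2)).add
    ((bil r t.1 t.1).mul (dbil r m t.2.1 t.2.2)))

/-- Enclosure of `disc`. -/
def disc (r : ℤ) (t : Fin 10 × Fin 10 × Fin 10) : Ival :=
  ((side r t.1 t.2.1).mul (side r t.1 t.2.2)).sub ((num r t).mul (num r t))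

/-- Half of an interval. -/
def half (I : Ival) : Ival := I.mul ⟨5000000000000000000000000000000000000000,
  5000000000000000000000000000000000000000⟩

/-- Enclosure of `dangle`. -/
def dangle (r : ℤ) (m : Fin 10) (t : Fin 10 × Fin 10 × Fin 10) : Ival :=
  if m = t.1 ∨ m = t.2.1 ∨ m = t.2.2 then
    (((num r t).half.mul
      (((dside r m t.1 t.2.1).mul (side r t.1 t.2.1).inv).add
        ((dside r m t.1 t.2.2).mul (side r t.1 t.2.2).inv))).sub (dnum r m t)).mul
      (disc r t).sqrt.inv
  else ⟨0, 0⟩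

/-- The enclosures on the ball are good enough for the smoothness of the corner angles. -/
def regular (r : ℤ) (t : Fin 10 × Fin 10 × Fin 10) : Bool :=
  decide (1000000000000000000000000000000000000000 < (side r t.1 t.2.1).lo) &&
  decide (1000000000000000000000000000000000000000 < (side r t.1 t.2.2).lo) &&
  decide (100000000000000000000000000000000000000 < (disc r t).lo) &&
  decide (0 < (disc r t).sqrt.lo)

/-- The error bound `10 ^ (-18)`. -/
def radius : ℤ := 10000000000000000000000

theorem bil_self_pos : ∀ p, 0 < (bil radius p p).lo := by decide +kernel

theorem regular_radius : cornerList.all (regular radius) = true := by decide +kernel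

/-- The enclosure of a partial derivative of a cone angle is close to the entry of `M`. -/
def close (m v : Fin 10) : Bool :=
  let s := sum ((cornersAt v).map (dangle radius m))
  decide ((mInt m v - 2) * 10000000000000000000000000000000000000 < s.lo) &&
    decide (s.hi < (mInt m v + 2) * 10000000000000000000000000000000000000)

theorem close_all : ∀ m v, close m v = true := by decide +kernel

end Ival
-- Klein angles through Minkowski products
/-- The Minkowski product of the lifts `(1, X)` of two vertices. -/
noncomputable def bil (z : EuclideanSpace ℝ (Fin 10)) (p q : Fin 10) : ℝ :=
  1 - xCoord p * xCoord q - yCoord p * yCoord q - z p * z q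

/-- The squared Klein length of an edge at its first end point, up to a conformal factor. -/
noncomputable def side (z : EuclideanSpace ℝ (Fin 10)) (i j : Fin 10) : ℝ :=
  bil z i j * bil z i j - bil z i i * bil z j j

/-- The Klein inner product of two edges at a corner, up to a conformal factor. -/
noncomputable def num (z : EuclideanSpace ℝ (Fin 10)) (t : Fin 10 × Fin 10 × Fin 10) : ℝ :=
  bil z t.1 t.2.1 * bil z t.1 t.2.2 - bil z t.1 t.1 * bil z t.2.1 t.2.2

/-- The Gram determinant of the two edges at a corner. -/
noncomputable def disc (z : EuclideanSpace ℝ (Fin 10)) (t : Fin 10 × Fin 10 × Fin 10) : ℝ :=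
  side z t.1 t.2.1 * side z t.1 t.2.2 - num z t * num z t

/-- The angle at a corner, in terms of Minkowski products. -/
noncomputable def angle (z : EuclideanSpace ℝ (Fin 10)) (t : Fin 10 × Fin 10 × Fin 10) : ℝ :=
  Real.arccos (num z t / (√(side z t.1 t.2.1) * √(side z t.1 t.2.2)))

/-- The derivative of `bil` in the direction of the `m`-th coordinate. -/
noncomputable def dbil (z : EuclideanSpace ℝ (Fin 10)) (m p q : Fin 10) : ℝ :=
  0 - ((if p = m then z q else 0) + (if q = m then z p else 0))

/-- The derivative of `side` in the direction of the `m`-th coordinate. -/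
noncomputable def dside (z : EuclideanSpace ℝ (Fin 10)) (m i j : Fin 10) : ℝ :=
  (dbil z m i j * bil z i j + bil z i j * dbil z m i j) -
    (dbil z m i i * bil z j j + bil z i i * dbil z m j j)

/-- The derivative of `num` in the direction of the `m`-th coordinate. -/
noncomputable def dnum (z : EuclideanSpace ℝ (Fin 10)) (m : Fin 10)
    (t : Fin 10 × Fin 10 × Fin 10) : ℝ :=
  (dbil z m t.1 t.2.1 * bil z t.1 t.2.2 + bil z t.1 t.2.1 * dbil z m t.1 t.2.2) -
    (dbil z m t.1 t.1 * bil z t.2.1 t.2.2 + bil z t.1 t.1 * dbil z m t.2.1 t.2.2)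

/-- The derivative of `angle` in the direction of the `m`-th coordinate. -/
noncomputable def dangle (z : EuclideanSpace ℝ (Fin 10)) (m : Fin 10)
    (t : Fin 10 × Fin 10 × Fin 10) : ℝ :=
  (num z t * (1 / 2) * (dside z m t.1 t.2.1 * (side z t.1 t.2.1)⁻¹ +
    dside z m t.1 t.2.2 * (side z t.1 t.2.2)⁻¹) - dnum z m t) * (√(disc z t))⁻¹

/-- With `B = 1 - ‖X‖²`, one has `⟨X, Y - X⟩ = B - bil(X, Y)`, and expanding cancels everything but
a 2×2 minor. The factor `B⁻²` disappears from the cosine, and `side` is the case `j = k` of `num`.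
-/
theorem kleinInner_vertex (z : EuclideanSpace ℝ (Fin 10)) (i j k : Fin 10) (h : bil z i i ≠ 0) :
    kleinInner (vertex z i) (vertex z j - vertex z i) (vertex z k - vertex z i) =
      num z (i, j, k) / bil z i i ^ 2 := by
  have hn : 1 - ‖vertex z i‖ ^ 2 = bil z i i := by
    simp [EuclideanSpace.real_norm_sq_eq, vertex, Fin.sum_univ_three, bil]
    ring
  rw [kleinInner, hn]
  field_simp
  simp [vertex, PiLp.inner_apply, Fin.sum_univ_three, bil, num]
  ring

theorem kleinAngle_vertex (z : EuclideanSpace ℝ (Fin 10)) (t : Fin 10 × Fin 10 × Fin 10)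
    (h : 0 < bil z t.1 t.1) :
    kleinAngle (vertex z t.1) (vertex z t.2.1) (vertex z t.2.2) = angle z t := by
  obtain ⟨i, j, k⟩ := t
  dsimp only at h ⊢
  have hs : ∀ j, kleinNorm (vertex z i) (vertex z j - vertex z i) =
      √(side z i j) / bil z i i := fun j => by
    rw [kleinNorm, kleinInner_vertex z i j j h.ne', Real.sqrt_div' _ (by positivity),
      Real.sqrt_sq h.le]
    rfl
  rw [kleinAngle, hs, hs, kleinInner_vertex z i j k h.ne', angle]
  congr 1
  dsimp only
  field_simp

/-! ### Validity of the enclosures near the centre -/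

/-- The third coordinates of `z` are within `r / scale` of those of `zHat`. -/
def Near (r : ℤ) (z : EuclideanSpace ℝ (Fin 10)) : Prop :=
  ∀ p, (Ival.coord r p).Contains (z p)

theorem near_zHat : Near 0 zHat := fun p => by
  rw [zHat_eq]
  simp only [Ival.Contains, Ival.coord, Ival.mkForced_eq, scale]
  constructor <;> push_cast <;> linarith

theorem near_of_mem_ball {z : EuclideanSpace ℝ (Fin 10)}
    (hz : z ∈ Metric.ball zHat ((10 : ℝ)⁻¹ ^ 18)) : Near Ival.radius z := fun p => by
  rw [Metric.mem_ball, dist_eq_norm] at hz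
  have h := (PiLp.norm_apply_le (z - zHat) p).trans_lt hz
  rw [Real.norm_eq_abs, abs_lt, PiLp.sub_apply, zHat_eq] at h
  simp only [Ival.Contains, Ival.coord, Ival.mkForced_eq, scale, Ival.radius]
  constructor <;> push_cast <;> norm_num at h ⊢ <;> linarith

theorem contains_bil {r : ℤ} {z : EuclideanSpace ℝ (Fin 10)} (h : Near r z)
    (p q : Fin 10) :
    (Ival.bil r p q).Contains (bil z p q) := by
  rw [Ival.bil, Ival.forceInt_eq]
  refine Ival.Contains.sub ?_ ((h p).mul (h q))
  rw [xCoord_eq, yCoord_eq, xCoord_eq, yCoord_eq]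
  convert! Ival.contains_ofInt _ using 1
  push_cast [scale]
  ring

theorem contains_zero : (⟨0, 0⟩ : Ival).Contains 0 := by simp [Ival.Contains]

theorem contains_dbil {r : ℤ} {z : EuclideanSpace ℝ (Fin 10)} (h : Near r z)
    (m p q : Fin 10) :
    (Ival.dbil r m p q).Contains (dbil z m p q) := by
  refine Ival.Contains.sub (contains_zero) (Ival.Contains.add ?_ ?_)
  · split_ifs
    exacts [h q, contains_zero]
  · split_ifs
    exacts [h p, contains_zero]

theorem contains_side {r : ℤ} {z : EuclideanSpace ℝ (Fin 10)} (h : Near r z)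
    (i j : Fin 10) :
    (Ival.side r i j).Contains (side z i j) :=
  ((contains_bil h i j).mul (contains_bil h i j)).sub
    ((contains_bil h i i).mul (contains_bil h j j))

theorem contains_dside {r : ℤ} {z : EuclideanSpace ℝ (Fin 10)} (h : Near r z)
    (m i j : Fin 10) :
    (Ival.dside r m i j).Contains (dside z m i j) :=
  (((contains_dbil h m i j).mul (contains_bil h i j)).add
    ((contains_bil h i j).mul (contains_dbil h m i j))).sub
  (((contains_dbil h m i i).mul (contains_bil h j j)).add
    ((contains_bil h i i).mul (contains_dbil h m j j)))

theorem contains_num {r : ℤ} {z : EuclideanSpace ℝ (Fin 10)} (h : Near r z)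
    (t : Fin 10 × Fin 10 × Fin 10) :
    (Ival.num r t).Contains (num z t) :=
  ((contains_bil h _ _).mul (contains_bil h _ _)).sub
    ((contains_bil h _ _).mul (contains_bil h _ _))

theorem contains_dnum {r : ℤ} {z : EuclideanSpace ℝ (Fin 10)} (h : Near r z)
    (m : Fin 10) (t : Fin 10 × Fin 10 × Fin 10) :
    (Ival.dnum r m t).Contains (dnum z m t) :=
  (((contains_dbil h _ _ _).mul (contains_bil h _ _)).add
    ((contains_bil h _ _).mul (contains_dbil h _ _ _))).sub
  (((contains_dbil h _ _ _).mul (contains_bil h _ _)).add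
    ((contains_bil h _ _).mul (contains_dbil h _ _ _)))

theorem contains_disc {r : ℤ} {z : EuclideanSpace ℝ (Fin 10)} (h : Near r z)
    (t : Fin 10 × Fin 10 × Fin 10) :
    (Ival.disc r t).Contains (disc z t) :=
  ((contains_side h _ _).mul (contains_side h _ _)).sub
    ((contains_num h t).mul (contains_num h t))

/-- The quantitative nondegeneracy of a corner. -/
structure Regular (z : EuclideanSpace ℝ (Fin 10)) (t : Fin 10 × Fin 10 × Fin 10) : Prop where
  side_left : 0.1 < side z t.1 t.2.1
  side_right : 0.1 < side z t.1 t.2.2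
  disc : 0.01 < disc z t

theorem lt_of_contains {I : Ival} {x y : ℝ} {n : ℤ} (hx : I.Contains x) (h : n < I.lo)
    (hy : y * scale ≤ n) : y < x := by
  have h1 : (n : ℝ) < I.lo := by exact_mod_cast h
  exact lt_of_mul_lt_mul_right (hy.trans_lt (h1.trans_le hx.1)) scale_pos.le

theorem gt_of_contains {I : Ival} {x y : ℝ} {n : ℤ} (hx : I.Contains x) (h : I.hi < n)
    (hy : n ≤ y * scale) : x < y := by
  have h1 : (I.hi : ℝ) < n := by exact_mod_cast h
  exact lt_of_mul_lt_mul_right ((hx.2.trans_lt h1).trans_le hy) scale_pos.le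

theorem regular_of_near {z : EuclideanSpace ℝ (Fin 10)} (h : Near Ival.radius z)
    {t : Fin 10 × Fin 10 × Fin 10} (ht : t ∈ cornerList) : Regular z t := by
  have hr := List.all_eq_true.1 Ival.regular_radius t ht
  simp only [Ival.regular, Bool.and_eq_true, decide_eq_true_eq] at hr
  obtain ⟨⟨⟨h1, h2⟩, h3⟩, -⟩ := hr
  exact ⟨lt_of_contains (contains_side h _ _) h1 (by norm_num [scale]),
    lt_of_contains (contains_side h _ _) h2 (by norm_num [scale]),
    lt_of_contains (contains_disc h _) h3 (by norm_num [scale])⟩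

theorem bil_self_pos {z : EuclideanSpace ℝ (Fin 10)} (h : Near Ival.radius z) (p : Fin 10) :
    0 < bil z p p := (contains_bil h p p).pos (Ival.bil_self_pos p)

theorem contains_dangle {z : EuclideanSpace ℝ (Fin 10)} (h : Near Ival.radius z)
    (m : Fin 10) {t : Fin 10 × Fin 10 × Fin 10} (ht : t ∈ cornerList) :
    (Ival.dangle Ival.radius m t).Contains (dangle z m t) := by
  have hr := List.all_eq_true.1 Ival.regular_radius t ht
  simp only [Ival.regular, Bool.and_eq_true, decide_eq_true_eq] at hr
  obtain ⟨⟨⟨h1, h2⟩, -⟩, h3⟩ := hr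
  replace h1 := lt_trans (by norm_num : (0 : ℤ) < _) h1
  replace h2 := lt_trans (by norm_num : (0 : ℤ) < _) h2
  rw [Ival.dangle]
  split_ifs with hm
  · refine Ival.Contains.mul (Ival.Contains.sub (Ival.Contains.mul (Ival.Contains.mul
      (contains_num h t) ?_) (Ival.Contains.add
        ((contains_dside h _ _ _).mul ((contains_side h _ _).inv h1))
        ((contains_dside h _ _ _).mul ((contains_side h _ _).inv h2)))) (contains_dnum h m t))
      (((contains_disc h t).sqrt (by linarith [(regular_of_near h ht).disc])).inv h3)
    convert! Ival.contains_ofInt _ using 1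
    norm_num [scale]
  -- The angle does not depend on a coordinate foreign to its triangle; the exact zero interval is
  -- then correct.
  · have h0 : ∀ p q, p ≠ m → q ≠ m → dbil z m p q = 0 := fun p q hp hq => by simp [dbil, hp, hq]
    push Not at hm
    obtain ⟨hi, hj, hk⟩ := hm
    have := contains_zero
    simpa [dangle, dside, dnum, h0, hi.symm, hj.symm, hk.symm]

/-! ### Directional derivatives and bounds on values and first derivatives -/

section LineDeriv

variable {E : Type*} [NormedAddCommGroup E] [NormedSpace ℝ E] {f g : E → ℝ} {f' g' : ℝ} {z v : E}

theorem hasLineDerivAt_mul (hf : HasLineDerivAt ℝ f f' z v) (hg : HasLineDerivAt ℝ g g' z v) :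
    HasLineDerivAt ℝ (fun x => f x * g x) (f' * g z + f z * g') z v := by
  have := HasDerivAt.mul hf hg
  simp only [zero_smul, add_zero] at this
  exact this

theorem hasLineDerivAt_sub (hf : HasLineDerivAt ℝ f f' z v) (hg : HasLineDerivAt ℝ g g' z v) :
    HasLineDerivAt ℝ (fun x => f x - g x) (f' - g') z v := HasDerivAt.sub hf hg

theorem hasLineDerivAt_add (hf : HasLineDerivAt ℝ f f' z v) (hg : HasLineDerivAt ℝ g g' z v) :
    HasLineDerivAt ℝ (fun x => f x + g x) (f' + g') z v := HasDerivAt.add hf hg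

theorem hasLineDerivAt_const (c : ℝ) : HasLineDerivAt ℝ (fun _ : E => c) 0 z v :=
  hasDerivAt_const _ _

theorem hasLineDerivAt_inv (hf : HasLineDerivAt ℝ f f' z v) (h : f z ≠ 0) :
    HasLineDerivAt ℝ (fun x => (f x)⁻¹) (-f' / f z ^ 2) z v := by
  have := HasDerivAt.inv hf (by simpa using h)
  simp only [zero_smul, add_zero] at this
  exact this

theorem hasLineDerivAt_sqrt (hf : HasLineDerivAt ℝ f f' z v) (h : f z ≠ 0) :
    HasLineDerivAt ℝ (fun x => √(f x)) (f' / (2 * √(f z))) z v := by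
  have := HasDerivAt.sqrt hf (by simpa using h)
  simp only [zero_smul, add_zero] at this
  exact this

theorem hasLineDerivAt_list_sum {α : Type*} {F : α → E → ℝ} {F' : α → ℝ} (l : List α)
    (h : ∀ a ∈ l, HasLineDerivAt ℝ (F a) (F' a) z v) :
    HasLineDerivAt ℝ (fun x => (l.map fun a => F a x).sum) (l.map F').sum z v := by
  induction l with
  | nil => simpa using hasLineDerivAt_const 0
  | cons a l ih =>
    simp only [List.map_cons, List.sum_cons]
    exact hasLineDerivAt_add (h a (by simp)) (ih fun b hb => h b (by simp [hb]))

end LineDeriv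

/-- `f` is bounded by `b` at `z`, and its derivative in the direction `v` exists and is bounded
by `b'`. -/
structure JetBound {E : Type*} [NormedAddCommGroup E] [NormedSpace ℝ E] (z v : E) (f : E → ℝ)
    (b b' : ℝ) : Prop where
  bound : |f z| ≤ b
  deriv : ∃ f', HasLineDerivAt ℝ f f' z v ∧ |f'| ≤ b'

namespace JetBound

variable {E : Type*} [NormedAddCommGroup E] [NormedSpace ℝ E] {z v : E} {f g : E → ℝ}
  {a a' b b' : ℝ}

theorem add (hf : JetBound z v f a a') (hg : JetBound z v g b b') :
    JetBound z v (fun x => f x + g x) (a + b) (a' + b') := by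
  obtain ⟨hf, f', hf1, hf2⟩ := hf
  obtain ⟨hg, g', hg1, hg2⟩ := hg
  exact ⟨(abs_add_le _ _).trans (add_le_add hf hg), _, hasLineDerivAt_add hf1 hg1,
    (abs_add_le _ _).trans (add_le_add hf2 hg2)⟩

theorem sub (hf : JetBound z v f a a') (hg : JetBound z v g b b') :
    JetBound z v (fun x => f x - g x) (a + b) (a' + b') := by
  obtain ⟨hf, f', hf1, hf2⟩ := hf
  obtain ⟨hg, g', hg1, hg2⟩ := hg
  exact ⟨(abs_sub _ _).trans (add_le_add hf hg), _, hasLineDerivAt_sub hf1 hg1,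
    (abs_sub _ _).trans (add_le_add hf2 hg2)⟩

theorem mul (hf : JetBound z v f a a') (hg : JetBound z v g b b') :
    JetBound z v (fun x => f x * g x) (a * b) (a' * b + a * b') := by
  obtain ⟨hf, f', hf1, hf2⟩ := hf
  obtain ⟨hg, g', hg1, hg2⟩ := hg
  have ha := (abs_nonneg _).trans hf
  have ha' := (abs_nonneg _).trans hf2
  refine ⟨?_, _, hasLineDerivAt_mul hf1 hg1, (abs_add_le _ _).trans ?_⟩
  · rw [abs_mul]; gcongr
  · rw [abs_mul, abs_mul]; gcongr

theorem const (c : ℝ) : JetBound z v (fun _ => c) |c| 0 :=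
  ⟨le_rfl, 0, hasLineDerivAt_const c, by simp⟩

theorem inv (hf : JetBound z v f a a') {l : ℝ} (hl : 0 < l) (h : l ≤ f z) :
    JetBound z v (fun x => (f x)⁻¹) l⁻¹ (a' / l ^ 2) := by
  obtain ⟨hf, f', hf1, hf2⟩ := hf
  have h0 := hl.trans_le h
  have ha' := (abs_nonneg _).trans hf2
  refine ⟨?_, _, hasLineDerivAt_inv hf1 h0.ne', ?_⟩
  · rw [abs_of_pos (by positivity)]; gcongr
  · rw [abs_div, abs_neg, abs_of_pos (by positivity : 0 < f z ^ 2)]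
    gcongr

theorem sqrt (hf : JetBound z v f a a') {l : ℝ} (hl : 0 < l) (h : l ^ 2 ≤ f z) :
    JetBound z v (fun x => √(f x)) (a + 1) (a' / (2 * l)) := by
  obtain ⟨hf, f', hf1, hf2⟩ := hf
  have h0 : 0 < f z := (by positivity : 0 < l ^ 2).trans_le h
  have ha' := (abs_nonneg _).trans hf2
  have h1 : l ≤ √(f z) := Real.le_sqrt_of_sq_le h
  -- The bound on the value is the crude `√x ≤ x + 1`, which avoids a root in the constants.
  refine ⟨?_, _, hasLineDerivAt_sqrt hf1 h0.ne', ?_⟩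
  · rw [abs_of_nonneg (by positivity)]
    rw [abs_of_pos h0] at hf
    rw [Real.sqrt_le_iff]
    constructor <;> nlinarith
  · rw [abs_div, abs_of_pos (by positivity : 0 < 2 * √(f z))]
    gcongr

theorem list_sum {α : Type*} {F : α → E → ℝ} (l : List α) (h : ∀ t ∈ l, JetBound z v (F t) a a') :
    JetBound z v (fun x => (l.map fun t => F t x).sum) (l.length * a) (l.length * a') := by
  induction l with
  | nil => simpa using const (z := z) (v := v) 0
  | cons t l ih =>
    have := (h t (by simp)).add (ih fun b hb => h b (by simp [hb]))
    simp only [List.map_cons, List.sum_cons, List.length_cons]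
    convert! this using 1 <;> push_cast <;> ring

end JetBound

/-! ### Derivative and smoothness of a corner angle -/

/-- The unit vector of the `m`-th coordinate direction. -/
noncomputable def dir (m : Fin 10) : EuclideanSpace ℝ (Fin 10) := EuclideanSpace.single m 1

theorem hasLineDerivAt_coord (z : EuclideanSpace ℝ (Fin 10)) (m p : Fin 10) :
    HasLineDerivAt ℝ (fun z : EuclideanSpace ℝ (Fin 10) => z p) (if p = m then 1 else 0) z
      (dir m) := by
  have h := ((hasDerivAt_id (0 : ℝ)).mul_const (if p = m then 1 else 0 : ℝ)).const_add (z p)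
  rw [one_mul] at h
  refine h.congr_of_eventuallyEq (Filter.Eventually.of_forall fun s => ?_)
  simp [dir]

section Derivatives

variable (z : EuclideanSpace ℝ (Fin 10)) (m : Fin 10)

theorem hasLineDerivAt_bil (p q : Fin 10) :
    HasLineDerivAt ℝ (fun z => bil z p q) (dbil z m p q) z (dir m) := by
  have h := hasLineDerivAt_sub (hasLineDerivAt_const (1 - xCoord p * xCoord q - yCoord p * yCoord q))
    (hasLineDerivAt_mul (hasLineDerivAt_coord z m p) (hasLineDerivAt_coord z m q))
  convert! h using 1
  simp [dbil]

theorem hasLineDerivAt_side (i j : Fin 10) :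
    HasLineDerivAt ℝ (fun z => side z i j) (dside z m i j) z (dir m) :=
  hasLineDerivAt_sub (hasLineDerivAt_mul (hasLineDerivAt_bil z m _ _) (hasLineDerivAt_bil z m _ _))
    (hasLineDerivAt_mul (hasLineDerivAt_bil z m _ _) (hasLineDerivAt_bil z m _ _))

theorem hasLineDerivAt_num (t : Fin 10 × Fin 10 × Fin 10) :
    HasLineDerivAt ℝ (fun z => num z t) (dnum z m t) z (dir m) :=
  hasLineDerivAt_sub (hasLineDerivAt_mul (hasLineDerivAt_bil z m _ _) (hasLineDerivAt_bil z m _ _))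
    (hasLineDerivAt_mul (hasLineDerivAt_bil z m _ _) (hasLineDerivAt_bil z m _ _))

end Derivatives

section Regular

variable {z : EuclideanSpace ℝ (Fin 10)} {t : Fin 10 × Fin 10 × Fin 10} (ht : Regular z t)
include ht

theorem Regular.side_left_pos : 0 < side z t.1 t.2.1 := by linarith [ht.side_left]

theorem Regular.side_right_pos : 0 < side z t.1 t.2.2 := by linarith [ht.side_right]

theorem Regular.disc_pos : 0 < HypOrigami.disc z t := by linarith [ht.disc]

/-- The sine of the angle at a corner. -/
theorem Regular.sqrt_one_sub_sq :
    √(1 - (num z t / (√(side z t.1 t.2.1) * √(side z t.1 t.2.2))) ^ 2) =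
      √(HypOrigami.disc z t) / (√(side z t.1 t.2.1) * √(side z t.1 t.2.2)) := by
  have h1 := ht.side_left_pos
  have h2 := ht.side_right_pos
  rw [← Real.sqrt_mul h1.le, ← Real.sqrt_div' _ (by positivity)]
  congr 1
  rw [div_pow, Real.sq_sqrt (by positivity), HypOrigami.disc]
  field_simp

/-- Positivity of the Gram determinant makes the sine positive, which keeps the cosine away from
`±1`, where `arccos` is not differentiable. -/
theorem Regular.cos_mem :
    num z t / (√(side z t.1 t.2.1) * √(side z t.1 t.2.2)) ∈ Set.Ioo (-1 : ℝ) 1 := by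
  rw [Set.mem_Ioo, ← abs_lt, ← sq_lt_one_iff_abs_lt_one]
  have h1 := ht.side_left_pos
  have h2 := ht.side_right_pos
  have h3 := ht.disc_pos
  have h4 : 0 < √(1 - (num z t / (√(side z t.1 t.2.1) * √(side z t.1 t.2.2))) ^ 2) := by
    rw [ht.sqrt_one_sub_sq]
    positivity
  linarith [Real.sqrt_pos.1 h4]

/-- This is `-cos' / sin`: the common factor `√side √side` of sine and cosine cancels, and only
logarithmic derivatives of the two `side` terms remain. -/
theorem Regular.hasLineDerivAt_angle (m : Fin 10) :
    HasLineDerivAt ℝ (fun z => angle z t) (dangle z m t) z (dir m) := by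
  have h1 := ht.side_left_pos
  have h2 := ht.side_right_pos
  have h3 := ht.disc_pos
  have hc := hasLineDerivAt_mul (hasLineDerivAt_num z m t) (hasLineDerivAt_inv
    (hasLineDerivAt_mul (hasLineDerivAt_sqrt (hasLineDerivAt_side z m t.1 t.2.1) h1.ne')
      (hasLineDerivAt_sqrt (hasLineDerivAt_side z m t.1 t.2.2) h2.ne')) (by positivity))
  have hm := ht.cos_mem
  have ha := Real.hasDerivAt_arccos hm.1.ne' hm.2.ne
  rw [ht.sqrt_one_sub_sq, div_eq_mul_inv (num z t)] at ha
  have := HasDerivAt.comp (0 : ℝ) (by simpa using ha) hc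
  simp only [HasLineDerivAt]
  convert! this using 1
  have e1 := Real.sq_sqrt h1.le
  have e2 := Real.sq_sqrt h2.le
  have p1 := Real.sqrt_pos.2 h1
  have p2 := Real.sqrt_pos.2 h2
  have p3 := Real.sqrt_pos.2 h3
  rw [dangle]
  generalize √(side z t.1 t.2.1) = u at *
  generalize √(side z t.1 t.2.2) = w at *
  rw [← e1, ← e2]
  field_simp
  ring

theorem Regular.contDiffAt_angle : ContDiffAt ℝ ∞ (fun z => angle z t) z := by
  have hb : ∀ p q, ContDiffAt ℝ ∞ (fun z => bil z p q) z := fun p q => by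
    unfold bil
    fun_prop
  have hs : ∀ p q, ContDiffAt ℝ ∞ (fun z => side z p q) z := fun p q =>
    ((hb _ _).mul (hb _ _)).sub ((hb _ _).mul (hb _ _))
  have hn : ContDiffAt ℝ ∞ (fun z => num z t) z :=
    ((hb _ _).mul (hb _ _)).sub ((hb _ _).mul (hb _ _))
  have h1 := ht.side_left_pos
  have h2 := ht.side_right_pos
  have hm := ht.cos_mem
  exact (Real.contDiffAt_arccos hm.1.ne' hm.2.ne).comp z
    (hn.div (((hs _ _).sqrt h1.ne').mul ((hs _ _).sqrt h2.ne')) (by positivity))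

end Regular

/-! ### Crude bounds for the second derivatives -/

namespace JetBound

theorem mono {E : Type*} [NormedAddCommGroup E] [NormedSpace ℝ E] {z v : E} {f : E → ℝ}
    {a a' b b' : ℝ} (hf : JetBound z v f a a') (h : a ≤ b) (h' : a' ≤ b') :
    JetBound z v f b b' := by
  obtain ⟨hf, f', hf1, hf2⟩ := hf
  exact ⟨hf.trans h, f', hf1, hf2.trans h'⟩

section

variable {z : EuclideanSpace ℝ (Fin 10)}

theorem coord (h : ∀ p, |z p| ≤ 1) (j p : Fin 10) :
    JetBound z (dir j) (fun z : EuclideanSpace ℝ (Fin 10) => z p) 1 1 :=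
  ⟨h p, _, hasLineDerivAt_coord z j p, by split_ifs <;> simp⟩

theorem dbil (h : ∀ p, |z p| ≤ 1) (j m p q : Fin 10) :
    JetBound z (dir j) (fun z => HypOrigami.dbil z m p q) 2 2 := by
  have h0 : ∀ (c : Prop) [Decidable c] (p : Fin 10), JetBound z (dir j)
      (fun z : EuclideanSpace ℝ (Fin 10) => if c then z p else 0) 1 1 := fun c _ p => by
    split_ifs
    · exact coord h j p
    · exact (const 0).mono (by simp) (by simp)
  exact ((const 0).sub ((h0 _ q).add (h0 _ p))).mono (by norm_num) (by norm_num)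

theorem bil (h : ∀ p, |z p| ≤ 1) (hb : ∀ p q, |HypOrigami.bil z p q| ≤ 2) (j p q : Fin 10) :
    JetBound z (dir j) (fun z => HypOrigami.bil z p q) 2 2 :=
  ⟨hb p q, _, hasLineDerivAt_bil z j p q, (dbil h j j p q).bound⟩

theorem dangle (h : ∀ p, |z p| ≤ 1) (hb : ∀ p q, |HypOrigami.bil z p q| ≤ 2)
    {t : Fin 10 × Fin 10 × Fin 10} (ht : Regular z t) (j m : Fin 10) :
    JetBound z (dir j) (fun z => HypOrigami.dangle z m t) (10 ^ 5) (10 ^ 9) := by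
  have b := bil h hb j
  have d := dbil h j m
  have hs : ∀ p q, JetBound z (dir j) (fun z => side z p q) 8 16 := fun p q =>
    (((b _ _).mul (b _ _)).sub ((b _ _).mul (b _ _))).mono (by norm_num) (by norm_num)
  have hn : JetBound z (dir j) (fun z => num z t) 8 16 :=
    (((b _ _).mul (b _ _)).sub ((b _ _).mul (b _ _))).mono (by norm_num) (by norm_num)
  have hds : ∀ p q, JetBound z (dir j) (fun z => dside z m p q) 16 32 := fun p q =>
    ((((d _ _).mul (b _ _)).add ((b _ _).mul (d _ _))).sub
      (((d _ _).mul (b _ _)).add ((b _ _).mul (d _ _)))).mono (by norm_num) (by norm_num)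
  have hdn : JetBound z (dir j) (fun z => dnum z m t) 16 32 :=
    ((((d _ _).mul (b _ _)).add ((b _ _).mul (d _ _))).sub
      (((d _ _).mul (b _ _)).add ((b _ _).mul (d _ _)))).mono (by norm_num) (by norm_num)
  have hD : JetBound z (dir j) (fun z => disc z t) 128 512 :=
    (((hs _ _).mul (hs _ _)).sub (hn.mul hn)).mono (by norm_num) (by norm_num)
  have hl : (0.1 : ℝ) ^ 2 ≤ disc z t := by linarith [ht.disc]
  -- With `√disc ≥ 0.1`, the root has derivative at most `512 / 0.2 = 2560`, and inversion divides
  -- this by `0.1 ^ 2`.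
  have h1 : JetBound z (dir j) (fun z => (√(disc z t))⁻¹) 10 256000 :=
    ((hD.sqrt (by norm_num) hl).inv (by norm_num) (Real.le_sqrt_of_sq_le hl)).mono
      (by norm_num) (by norm_num)
  have h2 := (hds t.1 t.2.1).mul ((hs t.1 t.2.1).inv (by norm_num) ht.side_left.le)
  have h3 := (hds t.1 t.2.2).mul ((hs t.1 t.2.2).inv (by norm_num) ht.side_right.le)
  exact ((((hn.mul (const (1 / 2))).mul (h2.add h3)).sub hdn).mul h1).mono
    (by norm_num) (by norm_num)

end

end JetBound

section Bounds

variable {z : EuclideanSpace ℝ (Fin 10)}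

theorem abs_coord_le (h : ∀ p, 0 < bil z p p) (p : Fin 10) : |z p| ≤ 1 := by
  have := h p
  rw [bil] at this
  rw [← sq_le_one_iff_abs_le_one]
  nlinarith [mul_self_nonneg (xCoord p), mul_self_nonneg (yCoord p)]

/-- Both points lie in the unit ball, so `|X · Y| < 1` by the inequality of arithmetic and geometric
means, and `bil = 1 - X · Y`. -/
theorem abs_bil_le (h : ∀ p, 0 < bil z p p) (p q : Fin 10) : |bil z p q| ≤ 2 := by
  have h1 := h p
  have h2 := h q
  rw [bil] at h1 h2
  rw [abs_le, bil]
  constructor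
  · nlinarith [mul_self_nonneg (xCoord p - xCoord q), mul_self_nonneg (yCoord p - yCoord q),
      mul_self_nonneg (z p - z q)]
  · nlinarith [mul_self_nonneg (xCoord p + xCoord q), mul_self_nonneg (yCoord p + yCoord q),
      mul_self_nonneg (z p + z q)]

end Bounds

/-! ### The cone angle map on the ball -/

/-- The ball on which the proposition is stated. -/
def domain : Set (EuclideanSpace ℝ (Fin 10)) := Metric.ball zHat ((10 : ℝ)⁻¹ ^ 18)

theorem domain_mem_nhds {z : EuclideanSpace ℝ (Fin 10)} (hz : z ∈ domain) : domain ∈ nhds z :=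
  Metric.isOpen_ball.mem_nhds hz

theorem Theta_apply {z : EuclideanSpace ℝ (Fin 10)} (hz : ∀ p, 0 < bil z p p) (i : Fin 10) :
    Theta z i = ((cornersAt i).map fun t => angle z t).sum - 2 * Real.pi := by
  simp only [Theta, coneAngle]
  rw [Finset.sum_congr rfl fun t _ => kleinAngle_vertex z t (hz t.1), sum_corners]

section Domain

variable {z : EuclideanSpace ℝ (Fin 10)} (hz : z ∈ domain)
include hz

theorem bil_self_pos_of_mem (p : Fin 10) : 0 < bil z p p := bil_self_pos (near_of_mem_ball hz) p

theorem regular_of_mem {i : Fin 10} {t : Fin 10 × Fin 10 × Fin 10} (ht : t ∈ cornersAt i) :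
    Regular z t :=
  regular_of_near (near_of_mem_ball hz) (mem_corners_of_mem_cornersAt ht)

/-- The algebraic form of the angles requires the vertices to be in the unit ball, so it holds only
locally; that is enough to transfer derivatives. -/
theorem Theta_eventuallyEq (i : Fin 10) :
    (fun w => Theta w i) =ᶠ[nhds z]
      fun w => ((cornersAt i).map fun t => angle w t).sum - 2 * Real.pi := by
  filter_upwards [domain_mem_nhds hz] with w hw
  exact Theta_apply (bil_self_pos_of_mem hw) i

theorem contDiffAt_Theta_apply (i : Fin 10) : ContDiffAt ℝ ∞ (fun w => Theta w i) z := by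
  refine ContDiffAt.congr_of_eventuallyEq ?_ (Theta_eventuallyEq hz i)
  refine ContDiffAt.sub ?_ contDiffAt_const
  have : ∀ l : List (Fin 10 × Fin 10 × Fin 10), (∀ t ∈ l, Regular z t) →
      ContDiffAt ℝ ∞ (fun w => (l.map fun t => angle w t).sum) z := fun l => by
    induction l with
    | nil => intro _; simpa using contDiffAt_const
    | cons t l ih =>
      intro h
      simp only [List.map_cons, List.sum_cons]
      exact (h t (by simp)).contDiffAt_angle.add (ih fun s hs => h s (by simp [hs]))
  exact this _ fun t ht => regular_of_mem hz ht

theorem contDiffAt_Theta : ContDiffAt ℝ ∞ Theta z :=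
  (contDiffAt_piLp 2).2 fun i => contDiffAt_Theta_apply hz i

theorem partialDeriv_Theta (m i : Fin 10) :
    partialDeriv m (fun w => Theta w i) z = ((cornersAt i).map (dangle z m)).sum := by
  have h1 : HasLineDerivAt ℝ (fun w => Theta w i) ((cornersAt i).map (dangle z m)).sum z
      (dir m) := by
    refine HasLineDerivAt.congr_of_eventuallyEq ?_ (Theta_eventuallyEq hz i)
    simpa using hasLineDerivAt_sub (hasLineDerivAt_list_sum (cornersAt i) fun t ht =>
      (regular_of_mem hz ht).hasLineDerivAt_angle m) (hasLineDerivAt_const (2 * Real.pi))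
  have h2 := ((contDiffAt_Theta_apply hz i).differentiableAt (by simp)).lineDeriv_eq_fderiv
    (v := dir m)
  rw [h1.lineDeriv] at h2
  exact h2.symm

theorem abs_partialDeriv_sub_M_lt (m i : Fin 10) :
    |partialDeriv m (fun w => Theta w i) z - M m i| < 0.002 := by
  have h := Ival.contains_sum (dangle z m) (Ival.dangle Ival.radius m) (cornersAt i) fun t ht =>
    contains_dangle (near_of_mem_ball hz) m (mem_corners_of_mem_cornersAt ht)
  have hc := Ival.close_all m i
  simp only [Ival.close, Bool.and_eq_true, decide_eq_true_eq] at hc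
  rw [partialDeriv_Theta hz, M_eq, abs_sub_lt_iff, sub_lt_iff_lt_add, sub_lt_comm]
  constructor
  · refine gt_of_contains h hc.2 (le_of_eq ?_)
    push_cast [scale]
    ring
  · refine lt_of_contains h hc.1 (le_of_eq ?_)
    push_cast [scale]
    ring

theorem abs_partialDeriv_partialDeriv_le (i j k : Fin 10) :
    |partialDeriv j (partialDeriv k fun w => Theta w i) z| ≤ 10 ^ 14 := by
  have hd : DifferentiableAt ℝ (partialDeriv k fun w => Theta w i) z := by
    have h := (contDiffAt_Theta_apply hz i).fderiv_right (m := 1) (by decide)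
    exact (h.differentiableAt (by simp)).clm_apply (differentiableAt_const _)
  have he : (partialDeriv k fun w => Theta w i) =ᶠ[nhds z]
      fun w => ((cornersAt i).map fun t => dangle w k t).sum := by
    filter_upwards [domain_mem_nhds hz] with w hw
    exact partialDeriv_Theta hw k i
  have hp := bil_self_pos_of_mem hz
  obtain ⟨f', hf, hf'⟩ := (JetBound.list_sum (cornersAt i) fun t ht =>
    JetBound.dangle (abs_coord_le hp) (abs_bil_le hp) (regular_of_mem hz ht) j k).deriv
  have h2 := hd.lineDeriv_eq_fderiv (v := dir j)
  rw [(hf.congr_of_eventuallyEq he).lineDeriv] at h2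
  change |fderiv ℝ _ z (dir j)| ≤ _
  rw [← h2]
  refine hf'.trans ?_
  -- The total number of corners is a wasteful but sufficient count: `72 * 10 ^ 9 < 10 ^ 14`.
  have hl : ((cornersAt i).length : ℝ) ≤ 72 := by
    have : (cornersAt i).length ≤ 72 := List.length_filter_le _ _
    exact_mod_cast this
  linarith

theorem vertex_mem_ball (i : Fin 10) :
    vertex z i ∈ Metric.ball (0 : EuclideanSpace ℝ (Fin 3)) 1 := by
  have h := bil_self_pos_of_mem hz i
  rw [mem_ball_zero_iff, ← sq_lt_one_iff₀ (norm_nonneg _), EuclideanSpace.real_norm_sq_eq]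
  simp only [vertex, Fin.sum_univ_three]
  simp only [bil] at h
  simp
  linarith

end Domain

/-! ### Nondegeneracy of the triangles -/

theorem plane_det_ne_zero : ∀ t ∈ faces,
    (xInt t.2.1 - xInt t.1) * (yInt t.2.2 - yInt t.1) -
      (xInt t.2.2 - xInt t.1) * (yInt t.2.1 - yInt t.1) ≠ 0 := by decide +kernel

/-- The projections to the `xy`-plane do not depend on `z` and are already nondegenerate triangles,
so no condition on `z` is needed. -/
theorem affineIndependent_vertex (z : EuclideanSpace ℝ (Fin 10)) {t : Fin 10 × Fin 10 × Fin 10}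
    (ht : t ∈ faces) : AffineIndependent ℝ ![vertex z t.1, vertex z t.2.1, vertex z t.2.2] := by
  have hdet := plane_det_ne_zero t ht
  obtain ⟨i, j, k⟩ := t
  dsimp only at hdet ⊢
  have hdet' : (xCoord j - xCoord i) * (yCoord k - yCoord i) -
      (xCoord k - xCoord i) * (yCoord j - yCoord i) ≠ 0 := by
    have h : (((xInt j - xInt i) * (yInt k - yInt i) -
      (xInt k - xInt i) * (yInt j - yInt i) : ℤ) : ℝ) ≠ 0 := by exact_mod_cast hdet
    push_cast at h
    simp only [xCoord_eq, yCoord_eq]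
    contrapose! h
    linarith
  rw [affineIndependent_iff_linearIndependent_vsub ℝ _ 0]
  rw [← linearIndependent_equiv (finSuccAboveEquiv (0 : Fin 3))]
  have hpair : LinearIndependent ℝ ![vertex z j - vertex z i, vertex z k - vertex z i] := by
    rw [LinearIndependent.pair_iff]
    intro a b hab
    have h0 := congrArg (fun v : EuclideanSpace ℝ (Fin 3) => v 0) hab
    have h1 := congrArg (fun v : EuclideanSpace ℝ (Fin 3) => v 1) hab
    simp only [vertex, PiLp.add_apply, PiLp.smul_apply, PiLp.sub_apply, PiLp.zero_apply,
      smul_eq_mul] at h0 h1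
    simp at h0 h1
    -- Cramer's rule for the two horizontal coordinates of the relation.
    exact ⟨(mul_eq_zero_iff_right hdet').1 (by linear_combination (yCoord k - yCoord i) * h0 -
        (xCoord k - xCoord i) * h1),
      (mul_eq_zero_iff_right hdet').1 (by linear_combination (xCoord j - xCoord i) * h1 -
        (yCoord j - yCoord i) * h0)⟩
  convert! hpair using 1
  ext e : 1
  fin_cases e <;> rfl

/-! ### The spectrum of `Mᵀ M` and the singular values of `M` -/

theorem exists_inner_ne_zero {n E : Type*} [Fintype n] [NormedAddCommGroup E] [InnerProductSpace ℝ E]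
    (b : OrthonormalBasis n ℝ E) {v : E} (hv : v ≠ 0) : ∃ i, inner ℝ (b i) v ≠ 0 := by
  by_contra! h0
  exact hv (by simpa [h0] using (b.sum_sq_norm_inner_right v).symm)

section Spectral

variable {n : Type*} [Fintype n] [DecidableEq n] {A : Matrix n n ℝ} (hA : A.IsHermitian)

theorem inner_eigenvectorBasis_toEuclideanLin (v : EuclideanSpace ℝ n) (i : n) :
    inner ℝ (hA.eigenvectorBasis i) (Matrix.toEuclideanLin A v) =
      hA.eigenvalues i * inner ℝ (hA.eigenvectorBasis i) v := by
  have h : Matrix.toEuclideanLin A (hA.eigenvectorBasis i) =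
      hA.eigenvalues i • hA.eigenvectorBasis i := by
    ext j
    exact congrFun (hA.mulVec_eigenvectorBasis i) j
  rw [← (Matrix.isSymmetric_toEuclideanLin_iff.2 hA) (hA.eigenvectorBasis i) v, h,
    real_inner_smul_left]

/-- Near an approximate eigenvalue of a Hermitian matrix there is an eigenvalue. -/
theorem exists_eigenvalue_near {v : EuclideanSpace ℝ n} {μ ε : ℝ} (hv : v ≠ 0) (hε : 0 ≤ ε)
    (h : ‖Matrix.toEuclideanLin A v - μ • v‖ ^ 2 ≤ ε ^ 2 * ‖v‖ ^ 2) :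
    ∃ i, |hA.eigenvalues i - μ| ≤ ε := by
  -- If every eigenvalue were farther than `ε` from `μ`, each nonzero coefficient of `v` in an
  -- eigenbasis would be stretched by more than `ε`.
  by_contra! hc
  set b := hA.eigenvectorBasis
  have h1 : ∀ i, inner ℝ (b i) (Matrix.toEuclideanLin A v - μ • v) =
      (hA.eigenvalues i - μ) * inner ℝ (b i) v := fun i => by
    rw [inner_sub_right, inner_eigenvectorBasis_toEuclideanLin, real_inner_smul_right]
    ring
  rw [← b.sum_sq_norm_inner_right, ← b.sum_sq_norm_inner_right v, Finset.mul_sum] at h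
  have h2 : ∀ i, ε ^ 2 < (hA.eigenvalues i - μ) ^ 2 := fun i => by
    rw [← sq_abs (_ - μ)]
    have := hc i
    gcongr
  obtain ⟨i, hi⟩ : ∃ i, inner ℝ (b i) v ≠ 0 := exists_inner_ne_zero b hv
  refine h.not_gt (Finset.sum_lt_sum (fun j _ => ?_) ⟨i, Finset.mem_univ _, ?_⟩)
  · rw [h1, Real.norm_eq_abs, Real.norm_eq_abs, sq_abs, sq_abs, mul_pow]
    exact mul_le_mul_of_nonneg_right (h2 j).le (sq_nonneg _)
  · rw [h1, Real.norm_eq_abs, Real.norm_eq_abs, sq_abs, sq_abs, mul_pow]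
    exact mul_lt_mul_of_pos_right (h2 i) (by positivity)

theorem lt_inner_toEuclideanLin {c : ℝ} (hc : ∀ i, c < hA.eigenvalues i)
    {v : EuclideanSpace ℝ n} (hv : v ≠ 0) :
    c * ‖v‖ ^ 2 < inner ℝ v (Matrix.toEuclideanLin A v) := by
  set b := hA.eigenvectorBasis
  obtain ⟨i, hi⟩ : ∃ i, inner ℝ (b i) v ≠ 0 := exists_inner_ne_zero b hv
  rw [← b.sum_inner_mul_inner, ← b.sum_sq_norm_inner_right v, Finset.mul_sum]
  have e : ∀ j, inner ℝ v (b j) * inner ℝ (b j) (Matrix.toEuclideanLin A v) =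
      hA.eigenvalues j * inner ℝ (b j) v ^ 2 := fun j => by
    rw [inner_eigenvectorBasis_toEuclideanLin, real_inner_comm]
    ring
  refine Finset.sum_lt_sum (fun j _ => ?_) ⟨i, Finset.mem_univ _, ?_⟩
  · rw [e, Real.norm_eq_abs, sq_abs]
    exact mul_le_mul_of_nonneg_right (hc j).le (sq_nonneg _)
  · rw [e, Real.norm_eq_abs, sq_abs]
    exact mul_lt_mul_of_pos_right (hc i) (by positivity)

end Spectral

/-- `10 ^ 6` times approximate eigenvalues of `Mᵀ M`. -/
def eigInt : Fin 10 → ℤ :=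
  ![2292117, 2527162, 9863338, 18017542, 29307697,
    33024661, 36895250, 51849719, 84673617, 205768744]

/-- The rows are approximate eigenvectors of `Mᵀ M`. -/
def eigVecInt : Matrix (Fin 10) (Fin 10) ℤ :=
  !![31096, 1773, 962, 2682, 7500, 89533, 18512, 835, 3134, 24418;
     -1926, -47878, -28209, -20157, -23302, 8412, -3470, -43608, -63004, -2225;
     -5954, -2382, 65857, 55035, 21296, -673, 433, -12387, -44548, 855;
     1716, -45610, 47305, -10171, -64508, 5576, -3322, 31202, 19920, -1357;
     -753, -37126, -42936, 76288, -10152, -1158, 962, -3455, 28992, -1;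
     54715, -1432, 3516, -539, -8126, -41497, 57703, -11059, -1523, 41826;
     -3896, 7019, 24836, -5701, -10381, 3951, -7299, -82583, 47593, -4953;
     -3821, -64639, 12295, -24397, 66682, -5373, 4930, 3987, 22980, 4149;
     75999, -3159, 1674, 2530, 7739, -8071, -58785, 753, -1825, -24907;
     -13822, 891, -1338, -150, -1630, -6974, -52633, -105, 84, 83575]

/-- `10 ^ 6` times the entries of `Mᵀ M`. -/
def gramInt : Matrix (Fin 10) (Fin 10) ℤ := mInt.transpose * mInt

/-- This is the residual bound with `ε = 0.02`, cleared of denominators: `2500 = 0.02⁻²`, and `10 ^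
12` is the squared common scale of `gramInt` and `eigInt`. -/
theorem eigVecInt_residual : ∀ k,
    2500 * ∑ i, (∑ j, gramInt i j * eigVecInt k j - eigInt k * eigVecInt k i) ^ 2 ≤
      1000000000000 * ∑ i, eigVecInt k i ^ 2 := by decide +kernel

theorem eigVecInt_pos : ∀ k, 0 < ∑ i, eigVecInt k i ^ 2 := by decide +kernel

/-- The gap `40000` is twice `0.02` at scale `10 ^ 6`, so the intervals around the approximate
eigenvalues are disjoint. -/
theorem eigInt_gap : ∀ k l, k < l → eigInt k + 40000 < eigInt l := by decide +kernel

theorem eigInt_lower : ∀ k, 2280000 < eigInt k := by decide +kernel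

theorem gram_isHermitian : (M.transpose * M).IsHermitian := by
  simpa using Matrix.isHermitian_conjTranspose_mul_self M

theorem gram_apply (i j : Fin 10) : (M.transpose * M) i j = gramInt i j / 10 ^ 6 := by
  simp only [gramInt, Matrix.mul_apply, Matrix.transpose_apply, M_eq]
  push_cast
  rw [Finset.sum_div]
  exact Finset.sum_congr rfl fun k _ => by ring

/-- The approximate eigenvectors of `Mᵀ M`. -/
noncomputable def eigVec (k : Fin 10) : EuclideanSpace ℝ (Fin 10) :=
  WithLp.toLp 2 fun i => (eigVecInt k i : ℝ)

theorem exists_eigenvalue_near_eigInt (k : Fin 10) :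
    ∃ i, |gram_isHermitian.eigenvalues i - eigInt k / 10 ^ 6| ≤ 0.02 := by
  have hn : ‖eigVec k‖ ^ 2 = ((∑ i, eigVecInt k i ^ 2 : ℤ) : ℝ) := by
    rw [EuclideanSpace.real_norm_sq_eq]
    push_cast
    rfl
  refine exists_eigenvalue_near (v := eigVec k) _ ?_ (by norm_num) ?_
  · rintro h
    rw [h, norm_zero, zero_pow two_ne_zero] at hn
    have : ∑ i, eigVecInt k i ^ 2 = 0 := by exact_mod_cast hn.symm
    exact (eigVecInt_pos k).ne' this
  · rw [hn, EuclideanSpace.real_norm_sq_eq]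
    have e : ∀ i, (Matrix.toEuclideanLin (M.transpose * M) (eigVec k) -
        (eigInt k / 10 ^ 6 : ℝ) • eigVec k) i =
        ((∑ j, gramInt i j * eigVecInt k j - eigInt k * eigVecInt k i : ℤ) : ℝ) / 10 ^ 6 :=
      fun i => by
      have h1 : Matrix.toEuclideanLin (M.transpose * M) (eigVec k) i =
          ∑ j, (M.transpose * M) i j * eigVecInt k j := rfl
      rw [PiLp.sub_apply, PiLp.smul_apply, h1]
      simp only [gram_apply, eigVec, smul_eq_mul]
      push_cast
      rw [sub_div, Finset.sum_div]
      congr 1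
      · exact Finset.sum_congr rfl fun j _ => by ring
      · ring
    simp only [e, div_pow]
    rw [← Finset.sum_div]
    have h : ((2500 * ∑ i, (∑ j, gramInt i j * eigVecInt k j - eigInt k * eigVecInt k i) ^ 2 : ℤ)
      : ℝ) ≤ ((1000000000000 * ∑ i, eigVecInt k i ^ 2 : ℤ) : ℝ) := by
      exact_mod_cast eigVecInt_residual k
    push_cast at h ⊢
    rw [div_le_iff₀ (by norm_num)]
    linarith

theorem exists_sorted_eigenvalues : ∃ σ : Fin 10 ≃ Fin 10,
    StrictMono (fun i => gram_isHermitian.eigenvalues (σ i)) ∧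
      ∀ i, 2.25 < gram_isHermitian.eigenvalues i := by
  choose σ hσ using exists_eigenvalue_near_eigInt
  have hmono : StrictMono fun i => gram_isHermitian.eigenvalues (σ i) := fun k l hkl => by
    have h : ((eigInt k + 40000 : ℤ) : ℝ) < eigInt l := by exact_mod_cast eigInt_gap k l hkl
    push_cast at h
    have hk := abs_le.1 (hσ k)
    have hl := abs_le.1 (hσ l)
    dsimp only
    linarith
  -- Ten disjoint intervals select ten different eigenvalues, hence all of them; only so does the
  -- lower bound, `2.28 - 0.02 > 2.25`, cover the whole spectrum.
  have hinj : Function.Injective σ := fun k l hkl => hmono.injective (by simp [hkl])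
  refine ⟨Equiv.ofBijective σ (Finite.injective_iff_bijective.1 hinj), hmono, fun i => ?_⟩
  obtain ⟨k, rfl⟩ := (Finite.injective_iff_surjective.1 hinj) i
  have h : ((2280000 : ℤ) : ℝ) < eigInt k := by exact_mod_cast eigInt_lower k
  push_cast at h
  have hk := abs_le.1 (hσ k)
  linarith

theorem charpoly_gram : ∃ x : Fin 10 → ℝ, StrictMono x ∧ (∀ i, (2.25 : ℝ) < x i) ∧
    (M.transpose * M).charpoly = ∏ i, (Polynomial.X - Polynomial.C (x i)) := by
  obtain ⟨σ, hσ, h⟩ := exists_sorted_eigenvalues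
  refine ⟨_, hσ, fun i => h _, ?_⟩
  rw [gram_isHermitian.charpoly_eq]
  exact (Equiv.prod_comp σ fun i =>
    Polynomial.X - Polynomial.C (gram_isHermitian.eigenvalues i)).symm

theorem adjoint_toEuclideanLin_M :
    LinearMap.adjoint (Matrix.toEuclideanLin M) = Matrix.toEuclideanLin M.transpose := by
  rw [← Matrix.toEuclideanLin_conjTranspose_eq_adjoint]
  simp

theorem adjoint_comp_self_M :
    LinearMap.adjoint (Matrix.toEuclideanLin M) ∘ₗ Matrix.toEuclideanLin M =
      Matrix.toEuclideanLin (M.transpose * M) := by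
  rw [adjoint_toEuclideanLin_M, Matrix.toLpLin_mul_same]

theorem lt_norm_M {v : EuclideanSpace ℝ (Fin 10)} (hv : v ≠ 0) :
    2.25 * ‖v‖ ^ 2 < ‖Matrix.toEuclideanLin M v‖ ^ 2 := by
  obtain ⟨σ, -, h⟩ := exists_sorted_eigenvalues
  have := lt_inner_toEuclideanLin gram_isHermitian h hv
  rwa [← adjoint_comp_self_M, LinearMap.comp_apply, LinearMap.adjoint_inner_right,
    real_inner_self_eq_norm_sq] at this

/-- Singular values are in decreasing order and indexed from `0`, so index `9` is the smallest. Its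
square is an eigenvalue of `Mᵀ M`, and the lower bound for `‖M v‖` is applied to an eigenvector. -/
theorem lt_singularValues_M : (1.5 : ℝ) < (Matrix.toEuclideanLin M).singularValues 9 := by
  have h := (Matrix.toEuclideanLin M).hasEigenvalue_adjoint_comp_self_sq_singularValues
    (n := 9) (by simp)
  obtain ⟨v, hv, hv0⟩ := h.exists_hasEigenvector
  rw [Module.End.mem_eigenspace_iff] at hv
  have h1 := lt_norm_M hv0
  rw [← real_inner_self_eq_norm_sq (Matrix.toEuclideanLin M v), ← LinearMap.adjoint_inner_right,
    ← LinearMap.comp_apply, hv, RCLike.ofReal_real_eq_id, id, real_inner_smul_right,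
    real_inner_self_eq_norm_sq] at h1
  have h2 := lt_of_mul_lt_mul_right h1 (sq_nonneg _)
  refine lt_of_pow_lt_pow_left₀ 2 (LinearMap.singularValues_nonneg _ _) ?_
  norm_num at h2 ⊢
  exact h2

/-- The Jacobian is close to `Mᵀ`, not `M`. Writing `w = M v`, duality gives `‖w‖² = ⟨Mᵀ w, v⟩ ≤ ‖Mᵀ
w‖ ‖v‖`, and `‖v‖ ≤ ‖w‖ / 1.5`. -/
theorem le_norm_transpose_M (w : EuclideanSpace ℝ (Fin 10)) :
    1.5 * ‖w‖ ≤ ‖Matrix.toEuclideanLin M.transpose w‖ := by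
  have hM : ∀ v, 1.5 * ‖v‖ ≤ ‖Matrix.toEuclideanLin M v‖ := fun v => by
    rcases eq_or_ne v 0 with rfl | hv
    · simp
    · refine le_of_sq_le_sq ?_ (norm_nonneg _)
      have := lt_norm_M hv
      nlinarith
  have hinj : Function.Injective (Matrix.toEuclideanLin M) := by
    rw [injective_iff_map_eq_zero]
    intro v hv
    have := hM v
    rw [hv, norm_zero] at this
    exact norm_eq_zero.1 (le_antisymm (by linarith) (norm_nonneg _))
  obtain ⟨v, rfl⟩ := LinearMap.injective_iff_surjective.1 hinj w
  have h1 := hM v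
  set w := Matrix.toEuclideanLin M v with hw
  have h2 : ‖w‖ ^ 2 ≤ ‖Matrix.toEuclideanLin M.transpose w‖ * ‖v‖ := by
    rw [← real_inner_self_eq_norm_sq]
    nth_rw 2 [hw]
    rw [← LinearMap.adjoint_inner_left, adjoint_toEuclideanLin_M]
    exact real_inner_le_norm _ _
  rcases (norm_nonneg w).eq_or_lt with h0 | h0
  · rw [← h0]; simp
  · have h3 := norm_nonneg (Matrix.toEuclideanLin M.transpose w)
    have : ‖w‖ * (1.5 * ‖w‖) ≤ ‖w‖ * ‖Matrix.toEuclideanLin M.transpose w‖ := by nlinarith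
    exact le_of_mul_le_mul_left this h0

/-! ### Closeness of the differential to `Mᵀ` and expansiveness -/

/-- The transpose of `M` as a linear map, the approximate differential of `Theta`. -/
noncomputable def approxDeriv : EuclideanSpace ℝ (Fin 10) →L[ℝ] EuclideanSpace ℝ (Fin 10) :=
  LinearMap.toContinuousLinearMap (Matrix.toEuclideanLin M.transpose)

theorem approxDeriv_apply (V : EuclideanSpace ℝ (Fin 10)) (i : Fin 10) :
    approxDeriv V i = ∑ m, M m i * V m := rfl

theorem le_norm_approxDeriv (V : EuclideanSpace ℝ (Fin 10)) :
    1.5 * ‖V‖ ≤ ‖approxDeriv V‖ := le_norm_transpose_M V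

section Domain

variable {z : EuclideanSpace ℝ (Fin 10)} (hz : z ∈ domain)
include hz

theorem differentiableAt_Theta : DifferentiableAt ℝ Theta z :=
  (contDiffAt_Theta hz).differentiableAt (by simp)

theorem fderiv_Theta_apply (V : EuclideanSpace ℝ (Fin 10)) (i : Fin 10) :
    fderiv ℝ Theta z V i = ∑ m, partialDeriv m (fun w => Theta w i) z * V m := by
  have h := (EuclideanSpace.proj i : EuclideanSpace ℝ (Fin 10) →L[ℝ] ℝ).hasFDerivAt.comp z
    (differentiableAt_Theta hz).hasFDerivAt
  have h1 : fderiv ℝ (fun w => Theta w i) z V = fderiv ℝ Theta z V i := by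
    rw [HasFDerivAt.fderiv (f := fun w => Theta w i) h]
    rfl
  have hV : V = ∑ m, V m • EuclideanSpace.single m (1 : ℝ) := by
    ext j
    simp [Pi.single_apply]
  rw [← h1]
  nth_rw 1 [hV]
  rw [map_sum]
  refine Finset.sum_congr rfl fun m _ => ?_
  rw [map_smul, smul_eq_mul, mul_comm]
  rfl

/-- The Frobenius norm of a 10×10 matrix with entries below `0.002` is at most `10 * 0.002`; the
Cauchy–Schwarz inequality is applied to each component. -/
theorem norm_fderiv_Theta_sub_le (V : EuclideanSpace ℝ (Fin 10)) :
    ‖fderiv ℝ Theta z V - approxDeriv V‖ ≤ 0.02 * ‖V‖ := by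
  refine le_of_sq_le_sq ?_ (by positivity)
  rw [mul_pow, EuclideanSpace.real_norm_sq_eq, EuclideanSpace.real_norm_sq_eq V]
  have h : ∀ i, ((fderiv ℝ Theta z V - approxDeriv V) i) ^ 2 ≤ 0.00004 * ∑ m, V m ^ 2 := by
    intro i
    rw [PiLp.sub_apply, fderiv_Theta_apply hz, approxDeriv_apply, ← Finset.sum_sub_distrib]
    simp only [← sub_mul]
    refine (Finset.sum_mul_sq_le_sq_mul_sq _ _ _).trans ?_
    gcongr
    calc _ ≤ ∑ _m : Fin 10, (0.002 : ℝ) ^ 2 := Finset.sum_le_sum fun m _ => by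
          rw [← sq_abs]
          have := (abs_partialDeriv_sub_M_lt hz m i).le
          gcongr
      _ ≤ 0.00004 := by norm_num
  calc _ ≤ ∑ _i : Fin 10, 0.00004 * ∑ m, V m ^ 2 := Finset.sum_le_sum fun i _ => h i
    _ = 0.02 ^ 2 * ∑ m, V m ^ 2 := by
      rw [Finset.sum_const, Finset.card_fin]
      simp only [nsmul_eq_mul]
      ring

end Domain

/-- Two vectors that are close to a common vector of norm at least `1.5` make a small angle. -/
theorem angle_lt_pi_div_three {E : Type*} [NormedAddCommGroup E] [InnerProductSpace ℝ E]
    {a u w : E} (ha : 1.5 ≤ ‖a‖) (hu : ‖u - a‖ ≤ 0.02) (hw : ‖w - a‖ ≤ 0.02) :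
    InnerProductGeometry.angle u w < Real.pi / 3 := by
  have lower : ∀ u : E, ‖u - a‖ ≤ 0.02 → 1.48 ≤ ‖u‖ := fun u hu => by
    have := norm_sub_norm_le a (a - u)
    rw [sub_sub_cancel, norm_sub_rev] at this
    linarith
  have h1 := lower u hu
  have h2 := lower w hw
  have h3 : ‖u - w‖ ≤ 0.04 := by
    have := norm_sub_le (u - a) (w - a)
    rw [sub_sub_sub_cancel_right] at this
    linarith
  have h4 := norm_sub_sq_real u w
  have h5 : ‖u - w‖ ^ 2 ≤ 0.04 ^ 2 := by gcongr
  have hp : 0 < ‖u‖ * ‖w‖ := by nlinarith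
  rw [InnerProductGeometry.angle, ← Real.arccos_cos (by positivity : 0 ≤ Real.pi / 3)
    (by linarith [Real.pi_pos]), Real.cos_pi_div_three]
  refine Real.arccos_lt_arccos (by norm_num) ?_ ?_
  -- Polarization: `2⟨u, w⟩ ≥ 2‖u‖‖w‖ - 0.04²`, and `‖u‖‖w‖ ≥ 1.48²` exceeds the error.
  · rw [lt_div_iff₀ hp]
    nlinarith [sq_nonneg (‖u‖ - ‖w‖)]
  · rw [div_le_one hp]
    exact real_inner_le_norm u w

theorem isExpansiveOn_Theta : IsExpansiveOn (1 / 2 : ℝ) Theta domain := by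
  refine ⟨fun p hp => contDiffAt_Theta hp, fun V hV p hp q hq => ?_⟩
  have h0 := le_norm_approxDeriv V
  have h1 := norm_fderiv_Theta_sub_le hp V
  have h2 := norm_fderiv_Theta_sub_le hq V
  rw [hV, mul_one] at h0 h1 h2
  refine ⟨?_, angle_lt_pi_div_three h0 h1 h2⟩
  have := norm_sub_norm_le (approxDeriv V) (approxDeriv V - fderiv ℝ Theta p V)
  rw [sub_sub_cancel, norm_sub_rev] at this
  linarith

/-! ### The cone angles at the centre -/

namespace Ival

/-- Enclosure of the product of the complex numbers `num + √disc i` over a list of corners. -/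
def rotation (r : ℤ) : List (Fin 10 × Fin 10 × Fin 10) → Ival × Ival
  | [] => (⟨scale, scale⟩, ⟨0, 0⟩)
  | t :: l =>
    (((num r t).mul (rotation r l).1).sub ((disc r t).sqrt.mul (rotation r l).2),
      ((disc r t).sqrt.mul (rotation r l).1).add ((num r t).mul (rotation r l).2))

/-- The product of the rotations around `v` is the identity to high accuracy. -/
def closesUp (v : Fin 10) : Bool :=
  let p := rotation 0 (cornersAt v)
  decide (0 < p.1.lo) && decide (-p.1.lo ≤ 100000000000000000000 * p.2.lo) &&
    decide (100000000000000000000 * p.2.hi ≤ p.1.lo)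

theorem closesUp_all : ∀ v, closesUp v = true := by decide +kernel

/-- An upper bound for the angle at a corner, in multiples of `π / 4`. -/
def octants (t : Fin 10 × Fin 10 × Fin 10) : ℕ :=
  if 0 < (num radius t).lo then
    if ((side radius t.1 t.2.1).mul (side radius t.1 t.2.2)).hi ≤
      2 * ((num radius t).mul (num radius t)).lo then 1 else 2
  else 4

/-- A total of `14` octants is `2π + 3π/2`. Beyond `2π`, the cosine becomes positive again only
after this bound, so cone angles near `4π` and higher multiples are excluded. -/
theorem octants_sum_le : ∀ v, ((cornersAt v).map octants).sum ≤ 14 := by decide +kernel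

end Ival

theorem zHat_mem_domain : zHat ∈ domain := Metric.mem_ball_self (by positivity)

section Corner

variable {z : EuclideanSpace ℝ (Fin 10)} {t : Fin 10 × Fin 10 × Fin 10} (ht : Regular z t)
include ht

theorem Regular.cos_angle :
    Real.cos (angle z t) = num z t / (√(side z t.1 t.2.1) * √(side z t.1 t.2.2)) :=
  Real.cos_arccos ht.cos_mem.1.le ht.cos_mem.2.le

theorem Regular.sin_angle :
    Real.sin (angle z t) = √(HypOrigami.disc z t) / (√(side z t.1 t.2.1) * √(side z t.1 t.2.2)) := by
  rw [angle, Real.sin_arccos, ht.sqrt_one_sub_sq]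

theorem Regular.radius_pos : 0 < √(side z t.1 t.2.1) * √(side z t.1 t.2.2) :=
  mul_pos (Real.sqrt_pos.2 ht.side_left_pos) (Real.sqrt_pos.2 ht.side_right_pos)

theorem Regular.le_angle (hp : ∀ p, 0 < bil z p p) : 0.02 ≤ angle z t := by
  refine le_trans ?_ (Real.sin_le (Real.arccos_nonneg _))
  -- Since `side ≤ bil² ≤ 4`, the sine is at least `0.1 / (2 * 2) = 0.025`.
  have hs : ∀ i j, √(side z i j) ≤ 2 := fun i j => by
    rw [Real.sqrt_le_iff]
    refine ⟨by norm_num, ?_⟩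
    have h1 := sq_le_sq' (abs_le.1 (abs_bil_le hp i j)).1 (abs_le.1 (abs_bil_le hp i j)).2
    have h2 := mul_pos (hp i) (hp j)
    rw [side]
    linarith
  rw [ht.sin_angle, le_div_iff₀ ht.radius_pos]
  have h1 : (0.1 : ℝ) ≤ √(HypOrigami.disc z t) :=
    Real.le_sqrt_of_sq_le (by linarith [ht.disc])
  have h2 : √(side z t.1 t.2.1) * √(side z t.1 t.2.2) ≤ 2 * 2 :=
    mul_le_mul (hs _ _) (hs _ _) (Real.sqrt_nonneg _) (by norm_num)
  linarith

theorem Regular.angle_le_pi_div_two (h : 0 < num z t) : angle z t ≤ Real.pi / 2 :=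
  Real.arccos_le_pi_div_two.2 (div_pos h ht.radius_pos).le

theorem Regular.angle_le_pi_div_four (h : 0 < num z t)
    (h' : side z t.1 t.2.1 * side z t.1 t.2.2 ≤ 2 * (num z t * num z t)) :
    angle z t ≤ Real.pi / 4 := by
  refine Real.arccos_le_pi_div_four.2 ?_
  have hp := ht.radius_pos
  rw [div_le_iff₀ two_pos, Real.sqrt_le_iff]
  refine ⟨by positivity, ?_⟩
  rw [div_mul_eq_mul_div, div_pow, le_div_iff₀ (by positivity), mul_pow,
    Real.sq_sqrt ht.side_left_pos.le, Real.sq_sqrt ht.side_right_pos.le]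
  linarith

end Corner

theorem angle_le_octants {z : EuclideanSpace ℝ (Fin 10)} (hz : z ∈ domain)
    {i : Fin 10} {t : Fin 10 × Fin 10 × Fin 10} (ht : t ∈ cornersAt i) :
    angle z t ≤ Ival.octants t * (Real.pi / 4) := by
  have hr := regular_of_mem hz ht
  have hn := near_of_mem_ball hz
  rw [Ival.octants]
  split_ifs with h1 h2
  · rw [Nat.cast_one, one_mul]
    refine hr.angle_le_pi_div_four ((contains_num hn t).pos h1) ?_
    have h3 := ((contains_side hn t.1 t.2.1).mul (contains_side hn t.1 t.2.2)).2
    have h4 := ((contains_num hn t).mul (contains_num hn t)).1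
    have h5 : ((((Ival.side Ival.radius t.1 t.2.1).mul (Ival.side Ival.radius t.1 t.2.2)).hi : ℤ)
        : ℝ) ≤ ((2 * ((Ival.num Ival.radius t).mul (Ival.num Ival.radius t)).lo : ℤ) : ℝ) := by
      exact_mod_cast h2
    push_cast at h5
    refine le_of_mul_le_mul_right ?_ scale_pos
    linarith
  · have := hr.angle_le_pi_div_two ((contains_num hn t).pos h1)
    push_cast
    linarith
  · have : angle z t ≤ Real.pi := Real.arccos_le_pi _
    push_cast
    linarith

theorem angle_sum_le {z : EuclideanSpace ℝ (Fin 10)} (hz : z ∈ domain) (i : Fin 10) :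
    ((cornersAt i).map fun t => angle z t).sum ≤ 14 * (Real.pi / 4) := by
  have h1 : ((cornersAt i).map fun t => angle z t).sum ≤
      ((cornersAt i).map fun t => Ival.octants t * (Real.pi / 4)).sum :=
    List.sum_le_sum fun t ht => angle_le_octants hz ht
  rw [List.sum_map_mul_right] at h1
  have h2 : ((((cornersAt i).map Ival.octants).sum : ℕ) : ℝ) ≤ (14 : ℕ) := by
    exact_mod_cast Ival.octants_sum_le i
  rw [Nat.cast_list_sum, List.map_map] at h2
  refine h1.trans ?_
  gcongr
  exact_mod_cast h2

theorem le_angle_sum {z : EuclideanSpace ℝ (Fin 10)} (hz : z ∈ domain) (i : Fin 10) :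
    0.02 ≤ ((cornersAt i).map fun t => angle z t).sum := by
  obtain ⟨t, ht⟩ : ∃ t, t ∈ cornersAt i := by
    revert i
    decide +kernel
  refine ((regular_of_mem hz ht).le_angle (bil_self_pos_of_mem hz)).trans ?_
  refine List.single_le_sum (fun x hx => ?_) _ (List.mem_map_of_mem (f := fun t => angle z t) ht)
  obtain ⟨s, -, rfl⟩ := List.mem_map.1 hx
  exact Real.arccos_nonneg _

/-- The product of the complex numbers `num + √disc i` over a list of corners has the sum of the
corner angles as its argument. -/
theorem exists_rotation {r : ℤ} {z : EuclideanSpace ℝ (Fin 10)} (hz : Near r z)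
    (l : List (Fin 10 × Fin 10 × Fin 10)) (hl : ∀ t ∈ l, Regular z t) :
    ∃ R : ℝ, 0 < R ∧
      (Ival.rotation r l).1.Contains (R * Real.cos (l.map fun t => angle z t).sum) ∧
      (Ival.rotation r l).2.Contains (R * Real.sin (l.map fun t => angle z t).sum) := by
  induction l with
  | nil => exact ⟨1, one_pos, by simp [Ival.rotation, Ival.Contains]⟩
  | cons t l ih =>
    obtain ⟨R, hR, hc, hs⟩ := ih fun s hs => hl s (by simp [hs])
    have ht := hl t (by simp)
    have hq := ht.radius_pos
    refine ⟨√(side z t.1 t.2.1) * √(side z t.1 t.2.2) * R, mul_pos hq hR, ?_, ?_⟩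
    · convert! ((contains_num hz t).mul hc).sub
        (((contains_disc hz t).sqrt ht.disc_pos.le).mul hs) using 1
      rw [List.map_cons, List.sum_cons, Real.cos_add, ht.cos_angle, ht.sin_angle]
      generalize √(side z t.1 t.2.1) * √(side z t.1 t.2.2) = q at hq ⊢
      field_simp
    · convert! (((contains_disc hz t).sqrt ht.disc_pos.le).mul hc).add
        ((contains_num hz t).mul hs) using 1
      rw [List.map_cons, List.sum_cons, Real.sin_add, ht.cos_angle, ht.sin_angle]
      generalize √(side z t.1 t.2.1) * √(side z t.1 t.2.2) = q at hq ⊢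
      field_simp

theorem le_of_sin_le_mul_cos {x δ : ℝ} (h0 : 0 ≤ x) (h1 : x < Real.pi / 2)
    (h : Real.sin x ≤ δ * Real.cos x) : x ≤ δ := by
  have hc : 0 < Real.cos x := Real.cos_pos_of_mem_Ioo ⟨by linarith [Real.pi_pos], h1⟩
  refine (Real.le_tan h0 h1).trans ?_
  rwa [Real.tan_eq_sin_div_cos, div_le_iff₀ hc]

/-- A positive cosine and a small tangent place `S` near a multiple of `2π`. The hypothesis `δ < S`
rules out `0`, and the upper bound rules out every multiple beyond `2π`. -/
theorem abs_sub_two_pi_le {S δ : ℝ} (hS : S ≤ 14 * (Real.pi / 4)) (h0 : 0 ≤ S) (hδ : δ < S)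
    (hc : 0 < Real.cos S) (hs : |Real.sin S| ≤ δ * Real.cos S) : |S - 2 * Real.pi| ≤ δ := by
  have hpi := Real.pi_pos
  obtain ⟨hs1, hs2⟩ := abs_le.1 hs
  have h1 : Real.pi / 2 ≤ S := by
    by_contra! h
    exact (le_of_sin_le_mul_cos h0 h hs2).not_gt hδ
  have h2 : Real.pi + Real.pi / 2 < S := by
    by_contra! h
    exact (Real.cos_nonpos_of_pi_div_two_le_of_le h1 h).not_gt hc
  rw [← Real.cos_sub_two_pi] at hc hs1 hs2
  rw [← Real.sin_sub_two_pi] at hs1 hs2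
  have h3 : S - 2 * Real.pi < Real.pi / 2 := by
    by_contra! h
    exact (Real.cos_nonpos_of_pi_div_two_le_of_le h (by linarith)).not_gt hc
  rw [abs_le]
  rcases le_total 0 (S - 2 * Real.pi) with h | h
  · have := le_of_sin_le_mul_cos h h3 hs2
    constructor <;> linarith
  · have := le_of_sin_le_mul_cos (x := -(S - 2 * Real.pi)) (δ := δ) (by linarith) (by linarith)
      (by rw [Real.sin_neg, Real.cos_neg]; linarith)
    constructor <;> linarith

theorem abs_Theta_zHat_le (i : Fin 10) : |Theta zHat i| ≤ (10 : ℝ)⁻¹ ^ 20 := by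
  have hz := zHat_mem_domain
  rw [Theta_apply (bil_self_pos_of_mem hz)]
  -- At `zHat` the coordinates are exact, so radius `0` is used and the only width comes from
  -- rounding; the enclosure on the ball would be far too wide for an error of `10 ^ (-20)`.
  obtain ⟨R, hR, h1, h2⟩ := exists_rotation near_zHat (cornersAt i) fun t ht =>
    regular_of_mem hz ht
  have h3 := Ival.closesUp_all i
  simp only [Ival.closesUp, Bool.and_eq_true, decide_eq_true_eq] at h3
  obtain ⟨⟨h3, h4⟩, h5⟩ := h3
  have hl := le_angle_sum hz i
  refine abs_sub_two_pi_le (angle_sum_le hz i) (le_trans (by norm_num) hl)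
    (lt_of_lt_of_le (by norm_num) hl) (pos_of_mul_pos_right (h1.pos h3) hR.le) ?_
  generalize ((cornersAt i).map fun t => angle zHat t).sum = S at *
  have hs := scale_pos
  have h4' : ((-(Ival.rotation 0 (cornersAt i)).1.lo : ℤ) : ℝ) ≤
    ((100000000000000000000 * (Ival.rotation 0 (cornersAt i)).2.lo : ℤ) : ℝ) := by exact_mod_cast h4
  have h5' : ((100000000000000000000 * (Ival.rotation 0 (cornersAt i)).2.hi : ℤ) : ℝ) ≤
    (Ival.rotation 0 (cornersAt i)).1.lo := by exact_mod_cast h5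
  push_cast at h4' h5'
  have hRs : 0 < R * scale := mul_pos hR hs
  obtain ⟨h6, -⟩ := h1
  obtain ⟨h7, h8⟩ := h2
  rw [abs_le]
  constructor
  · refine le_of_mul_le_mul_right (a := R * scale) ?_ hRs
    norm_num
    linarith
  · refine le_of_mul_le_mul_right (a := R * scale) ?_ hRs
    norm_num
    linarith

theorem norm_Theta_zHat_le : ‖Theta zHat‖ ≤ (10 : ℝ)⁻¹ ^ 19 := by
  refine le_of_sq_le_sq ?_ (by positivity)
  rw [EuclideanSpace.real_norm_sq_eq]
  calc _ ≤ ∑ _i : Fin 10, ((10 : ℝ)⁻¹ ^ 20) ^ 2 := Finset.sum_le_sum fun i _ => by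
        rw [← sq_abs]
        have := abs_Theta_zHat_le i
        gcongr
    _ ≤ _ := by norm_num

/-! ### The exact zero -/

theorem approximatesLinearOn_Theta :
    ApproximatesLinearOn Theta approxDeriv domain ⟨0.02, by norm_num⟩ := fun _ hx _ hy =>
  (convex_ball _ _).norm_image_sub_le_of_norm_fderiv_le' (fun _ hp => differentiableAt_Theta hp)
    (fun _ hp => ContinuousLinearMap.opNorm_le_bound _ (NNReal.coe_nonneg _) fun V =>
      norm_fderiv_Theta_sub_le hp V) hy hx

/-- The inverse of the approximate differential. -/
noncomputable def approxDerivInverse : approxDeriv.NonlinearRightInverse :=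
  have hinj : Function.Injective (Matrix.toEuclideanLin M.transpose) := by
    rw [injective_iff_map_eq_zero]
    intro v hv
    have := le_norm_transpose_M v
    rw [hv, norm_zero] at this
    exact norm_eq_zero.1 (le_antisymm (by linarith) (norm_nonneg _))
  have hsurj : Function.Surjective approxDeriv := LinearMap.injective_iff_surjective.1 hinj
  { toFun := Function.surjInv hsurj
    -- The reciprocal of the expansion factor `1.5` of `Mᵀ`.
    nnnorm := ⟨2 / 3, by norm_num⟩
    bound' := fun y => by
      have := le_norm_approxDeriv (Function.surjInv hsurj y)
      rw [Function.surjInv_eq hsurj] at this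
      change _ ≤ (2 / 3 : ℝ) * _
      linarith
    right_inv' := Function.surjInv_eq hsurj }

/-- The image of the closed ball of radius `10 ^ (-19)` around `zHat` contains the closed ball of
radius `(1.5 - 0.02) * 10 ^ (-19)` around `Θ(zHat)`, and the latter contains `0`. -/
theorem exists_Theta_eq_zero :
    ∃ z ∈ Metric.ball zHat (5 * (10 : ℝ)⁻¹ ^ 19), Theta z = 0 := by
  have h := approximatesLinearOn_Theta.surjOn_closedBall_of_nonlinearRightInverse
    approxDerivInverse (ε := (10 : ℝ)⁻¹ ^ 19) (b := zHat) (by positivity)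
    (Metric.closedBall_subset_ball (by norm_num))
  have h0 : (0 : EuclideanSpace ℝ (Fin 10)) ∈ Metric.closedBall (Theta zHat)
      (((approxDerivInverse.nnnorm : ℝ)⁻¹ - ((⟨0.02, by norm_num⟩ : NNReal) : ℝ)) *
        (10 : ℝ)⁻¹ ^ 19) := by
    rw [Metric.mem_closedBall, dist_zero_left]
    refine norm_Theta_zHat_le.trans ?_
    change _ ≤ ((2 / 3 : ℝ)⁻¹ - 0.02) * _
    norm_num
  obtain ⟨z, hz, hz0⟩ := h h0
  exact ⟨z, Metric.closedBall_subset_ball (by norm_num) hz, hz0⟩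

end HypOrigami

theorem proposition4p3 :
    -- the surface is well defined on the ball: its vertices are points of hyperbolic space
    -- and its triangles are nondegenerate
    (∀ z ∈ Metric.ball HypOrigami.zHat ((10 : ℝ)⁻¹ ^ 18),
      (∀ i, HypOrigami.vertex z i ∈ Metric.ball (0 : EuclideanSpace ℝ (Fin 3)) 1) ∧
      (∀ t ∈ HypOrigami.faces, AffineIndependent ℝ
        ![HypOrigami.vertex z t.1, HypOrigami.vertex z t.2.1, HypOrigami.vertex z t.2.2])) ∧
    -- expansiveness
    HypOrigami.IsExpansiveOn (1 / 2 : ℝ) HypOrigami.Theta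
      (Metric.ball HypOrigami.zHat ((10 : ℝ)⁻¹ ^ 18)) ∧
    -- the second-order partial derivatives
    (∀ z ∈ Metric.ball HypOrigami.zHat ((10 : ℝ)⁻¹ ^ 18), ∀ i j k : Fin 10,
      |HypOrigami.partialDeriv j (HypOrigami.partialDeriv k (fun w => HypOrigami.Theta w i)) z|
        ≤ (10 : ℝ) ^ 14) ∧
    -- the differential is entrywise close to the explicit matrix
    (∀ z ∈ Metric.ball HypOrigami.zHat ((10 : ℝ)⁻¹ ^ 18), ∀ i j : Fin 10,
      |HypOrigami.partialDeriv i (fun w => HypOrigami.Theta w j) z - HypOrigami.M i j|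
        < (0.002 : ℝ)) ∧
    -- the characteristic polynomial of `Mᵀ M` and the smallest singular value of `M`
    (∃ x : Fin 10 → ℝ, StrictMono x ∧ (∀ i, (2.25 : ℝ) < x i) ∧
      (HypOrigami.M.transpose * HypOrigami.M).charpoly
        = ∏ i, (Polynomial.X - Polynomial.C (x i))) ∧
    (1.5 : ℝ) < (Matrix.toEuclideanLin HypOrigami.M).singularValues 9 ∧
    -- an exact zero
    (∃ z ∈ Metric.ball HypOrigami.zHat (5 * (10 : ℝ)⁻¹ ^ 19), HypOrigami.Theta z = 0) :=
  ⟨fun _ hz => ⟨HypOrigami.vertex_mem_ball hz,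
      fun _ ht => HypOrigami.affineIndependent_vertex _ ht⟩,
    HypOrigami.isExpansiveOn_Theta,
    fun _ hz => HypOrigami.abs_partialDeriv_partialDeriv_le hz,
    fun _ hz => HypOrigami.abs_partialDeriv_sub_M_lt hz,
    HypOrigami.charpoly_gram,
    HypOrigami.lt_singularValues_M,
    HypOrigami.exists_Theta_eq_zero⟩
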